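/- For complex $a,b,c$ with $c\notin\{0,-1,-2,\dots\}$ let $F(a,b;c;x)$, $x\in(-\infty,1)$, be the Gauss hypergeometric function, i.e. the analytic continuation to $(-\infty,1)$ of $\sum_{k\ge0}\frac{(a)_k(b)_k}{(c)_k\,k!}x^k$ ($|x|<1$). Define, for real $x$ (with the lower parameter of each $F$ not a non-positive integer), $$w_1(x;a,b,c)=F(a,b;c;x)\ (x<1),$$ $$w_2(x;a,b,c)=|x|^{1-c}F(a-c+1,b-c+1;2-c;x)\ (x<1,\ x\neq0),$$ $$w_3(x;a,b,c)=|x|^{-a}F(a,a-c+1;a-b+1;x^{-1})\ (x<0\text{ or }x>1),$$ $$w_4(x;a,b,c)=|x|^{-b}F(b,b-c+1;b-a+1;x^{-1})\ (x<0\text{ or }x>1),$$ $$w_5(x;a,b,c)=F(a,b;a+b-c+1;1-x)\ (x>0),$$ $$w_6(x;a,b,c)=|1-x|^{c-a-b}F(c-a,c-b;c-a-b+1;1-x)\ (x>0,\ x\neq1).$$ Let $a,b,c,\mu\in\mathbb C$. For an interval $S$ among $(-\infty,0)$, $(0,1)$, $(1,\infty)$, functions $f$ and $g$, and $A,B,C,D\in\mathbb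 C$, write $$\mathcal S_S\big[f\to g;\,A,B,C;\,D\big]$$ for the following assertion: if $A,B,C$ have positive real parts and $D\notin\{0,-1,-2,\dots\}$, then for every $x$ in one of the two other intervals among $(-\infty,0)$, $(0,1)$, $(1,\infty)$ the integral below converges absolutely and $$\int_S f(y)\,|x-y|^{\mu-1}\,dy=\frac{\Gamma(A)\Gamma(B)\Gamma(C)}{\Gamma(D)\Gamma(1-\mu)}\,g(x),$$ where $1/\Gamma(1-\mu)=0$ if $\mu$ is a positive integer. Below, $w_i$ without parameters on the left of the arrow is $w_i(y;a,b,c)$. Then the following 24 formulas hold. Case $c+$: 1. $\mathcal S_{(-\infty,0)}\big[|y|^{c-1}w_1\to|x|^{c+\mu-1}w_5(x;a,b,c+\mu);\ a-c-\mu+1,\ b-c-\mu+1,\ c;\ a+b-c-\mu+1\big]$ 2. $\mathcal S_{(1,\infty)}\big[|y|^{c-1}w_6\to|x|^{c+\mu-1}w_2(x;a,b,c+\mu);\ a-c-\mu+1,\ b-c-\mu+1,\ c-a-b+1;\ 2-c-\mu\big]$ Case $a+,c+$: 3. $\mathcal S_{(0,1)}\big[|y|^{c-1}|1-y|^{b-c-\mu}w_1\to|x|^{c+\mu-1}|1-x|^{b-c}w_4(x;a+\mu,b,c+\mu);\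 1-a-\mu,\ b-c-\mu+1,\ c;\ b-a-\mu+1\big]$ 4. $\mathcal S_{(1,\infty)}\big[|y|^{c-1}|1-y|^{b-c-\mu}w_3\to|x|^{c+\mu-1}|1-x|^{b-c}w_2(x;a+\mu,b,c+\mu);\ 1-a-\mu,\ b-c-\mu+1,\ a-b+1;\ 2-c-\mu\big]$ Case $b+,c+$: 5. $\mathcal S_{(0,1)}\big[|y|^{c-1}|1-y|^{a-c-\mu}w_1\to|x|^{c+\mu-1}|1-x|^{a-c}w_3(x;a,b+\mu,c+\mu);\ 1-b-\mu,\ a-c-\mu+1,\ c;\ a-b-\mu+1\big]$ 6. $\mathcal S_{(1,\infty)}\big[|y|^{c-1}|1-y|^{a-c-\mu}w_4\to|x|^{c+\mu-1}|1-x|^{a-c}w_2(x;a,b+\mu,c+\mu);\ 1-b-\mu,\ a-c-\mu+1,\ b-a+1;\ 2-c-\mu\big]$ Case $a+,b+,c+$: 7. $\mathcal S_{(-\infty,0)}\big[|y|^{c-1}|1-y|^{a+b-c}w_1\to|x|^{c+\mu-1}|1-x|^{a+b-c+\mu}w_6(x;a+\mu,b+\mu,c+\mu);\ 1-a-\mu,\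 1-b-\mu,\ c;\ c-a-b-\mu+1\big]$ 8. $\mathcal S_{(1,\infty)}\big[|y|^{c-1}|1-y|^{a+b-c}w_5\to|x|^{c+\mu-1}|1-x|^{a+b-c+\mu}w_2(x;a+\mu,b+\mu,c+\mu);\ 1-a-\mu,\ 1-b-\mu,\ a+b-c+1;\ 2-c-\mu\big]$ Case $a-$: 9. $\mathcal S_{(-\infty,0)}\big[|y|^{a-\mu-1}w_4\to|x|^{a-1}w_5(x;a-\mu,b,c);\ a-\mu,\ a-c-\mu+1,\ b-a+1;\ a+b-c-\mu+1\big]$ 10. $\mathcal S_{(0,1)}\big[|y|^{a-\mu-1}w_6\to|x|^{a-1}w_3(x;a-\mu,b,c);\ a-c-\mu+1,\ a-\mu,\ c-a-b+1;\ a-b-\mu+1\big]$ Case $b-$: 11. $\mathcal S_{(-\infty,0)}\big[|y|^{b-\mu-1}w_3\to|x|^{b-1}w_5(x;a,b-\mu,c);\ b-\mu,\ b-c-\mu+1,\ a-b+1;\ a+b-c-\mu+1\big]$ 12. $\mathcal S_{(0,1)}\big[|y|^{b-\mu-1}w_6\to|x|^{b-1}w_4(x;a,b-\mu,c);\ b-c-\mu+1,\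 b-\mu,\ c-a-b+1;\ b-a-\mu+1\big]$ Case $a+$: 13. $\mathcal S_{(-\infty,0)}\big[|y|^{c-a-\mu-1}|1-y|^{a+b-c}w_3\to|x|^{c-a-1}|1-x|^{a+b-c+\mu}w_6(x;a+\mu,b,c);\ 1-a-\mu,\ c-a-\mu,\ a-b+1;\ c-a-b-\mu+1\big]$ 14. $\mathcal S_{(0,1)}\big[|y|^{c-a-\mu-1}|1-y|^{a+b-c}w_5\to|x|^{c-a-1}|1-x|^{a+b-c+\mu}w_4(x;a+\mu,b,c);\ 1-a-\mu,\ c-a-\mu,\ a+b-c+1;\ b-a-\mu+1\big]$ Case $b+$: 15. $\mathcal S_{(-\infty,0)}\big[|y|^{c-b-\mu-1}|1-y|^{a+b-c}w_4\to|x|^{c-b-1}|1-x|^{a+b-c+\mu}w_6(x;a,b+\mu,c);\ 1-b-\mu,\ c-b-\mu,\ b-a+1;\ c-a-b-\mu+1\big]$ 16. $\mathcal S_{(0,1)}\big[|y|^{c-b-\mu-1}|1-y|^{a+b-c}w_5\to|x|^{c-b-1}|1-x|^{a+b-c+\mu}w_3(x;a,b+\mu,c);\ 1-b-\mu,\ c-b-\mu,\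 a+b-c+1;\ a-b-\mu+1\big]$ Case $a-,b-,c-$: 17. $\mathcal S_{(-\infty,0)}\big[w_2\to w_5(x;a-\mu,b-\mu,c-\mu);\ a-\mu,\ b-\mu,\ 2-c;\ a+b-c-\mu+1\big]$ 18. $\mathcal S_{(1,\infty)}\big[w_6\to w_1(x;a-\mu,b-\mu,c-\mu);\ a-\mu,\ b-\mu,\ c-a-b+1;\ c-\mu\big]$ Case $a-,c-$: 19. $\mathcal S_{(0,1)}\big[|1-y|^{a-\mu-1}w_2\to|1-x|^{a-1}w_3(x;a-\mu,b,c-\mu);\ c-b-\mu,\ a-\mu,\ 2-c;\ a-b-\mu+1\big]$ 20. $\mathcal S_{(1,\infty)}\big[|1-y|^{a-\mu-1}w_4\to|1-x|^{a-1}w_1(x;a-\mu,b,c-\mu);\ c-b-\mu,\ a-\mu,\ b-a+1;\ c-\mu\big]$ Case $b-,c-$: 21. $\mathcal S_{(0,1)}\big[|1-y|^{b-\mu-1}w_2\to|1-x|^{b-1}w_4(x;a,b-\mu,c-\mu);\ c-a-\mu,\ b-\mu,\ 2-c;\ b-a-\mu+1\big]$ 22. $\mathcal S_{(1,\infty)}\big[|1-y|^{b-\mu-1}w_3\to|1-x|^{b-1}w_1(x;a,b-\mu,c-\mu);\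 c-a-\mu,\ b-\mu,\ a-b+1;\ c-\mu\big]$ Case $c-$: 23. $\mathcal S_{(-\infty,0)}\big[|1-y|^{a+b-c}w_2\to|1-x|^{a+b-c+\mu}w_6(x;a,b,c-\mu);\ c-a-\mu,\ c-b-\mu,\ 2-c;\ c-a-b-\mu+1\big]$ 24. $\mathcal S_{(1,\infty)}\big[|1-y|^{a+b-c}w_5\to|1-x|^{a+b-c+\mu}w_1(x;a,b,c-\mu);\ c-a-\mu,\ c-b-\mu,\ a+b-c+1;\ c-\mu\big]$ -/

import Mathlib

open Set MeasureTheory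

namespace GaussStieltjes

noncomputable section

/-- `|t| ^ s` for real `t` and complex `s` (principal power of the positive number `|t|`). -/
def absPow (t : ℝ) (s : ℂ) : ℂ := ((|t| : ℝ) : ℂ) ^ s

/-- `f` is the continuation of the Gauss series `∑ (a)_k (b)_k / ((c)_k k!) x ^ k` from `(-1, 1)` to
a real-analytic function on `(-∞, 1)`. As `(-∞, 1)` is connected, `f` is determined on `(-∞, 1)`;
for `c ∉ {0, -1, -2, …}` it is there the restriction of the holomorphic continuation of the series
to `ℂ \ [1, ∞)`. -/
def IsGaussContinuation (a b c : ℂ) (f : ℝ → ℂ) : Prop :=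
  AnalyticOnNhd ℝ f (Iio 1) ∧ ∀ x : ℝ, |x| < 1 → f x = ordinaryHypergeometric a b c (x : ℂ)

/-- The Gauss hypergeometric function `F(a, b; c; x)` for real `x < 1` (and complex `a`, `b`, `c`
with `c ∉ {0, -1, -2, …}`): the analytic continuation of the Gauss series to `(-∞, 1)`. Its values
for `x ≥ 1` are never used. -/
def gaussF (a b c : ℂ) : ℝ → ℂ := Classical.epsilon (IsGaussContinuation a b c)

/-! The six explicit solutions of the hypergeometric differential equation on subintervals of the
real axis. -/

/-- `x ∈ (-∞, 1)`. -/
def w₁ (a b c : ℂ) (x : ℝ) : ℂ := gaussF a b c x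

/-- `x ∈ (-∞, 0) ∪ (0, 1)`. -/
def w₂ (a b c : ℂ) (x : ℝ) : ℂ :=
  absPow x (1 - c) * gaussF (a - c + 1) (b - c + 1) (2 - c) x

/-- `x ∈ (-∞, 0) ∪ (1, ∞)`. -/
def w₃ (a b c : ℂ) (x : ℝ) : ℂ :=
  absPow x (-a) * gaussF a (a - c + 1) (a - b + 1) x⁻¹

/-- `x ∈ (-∞, 0) ∪ (1, ∞)`. -/
def w₄ (a b c : ℂ) (x : ℝ) : ℂ :=
  absPow x (-b) * gaussF b (b - c + 1) (b - a + 1) x⁻¹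

/-- `x ∈ (0, ∞)`. -/
def w₅ (a b c : ℂ) (x : ℝ) : ℂ := gaussF a b (a + b - c + 1) (1 - x)

/-- `x ∈ (0, 1) ∪ (1, ∞)`. -/
def w₆ (a b c : ℂ) (x : ℝ) : ℂ :=
  absPow (1 - x) (c - a - b) * gaussF (c - a) (c - b) (c - a - b + 1) (1 - x)

/-- The generalized Stieltjes transform formula
`∫_S f(y) |x - y| ^ (μ - 1) dy = Γ(A) Γ(B) Γ(C) / (Γ(D) Γ(1 - μ)) * g(x)`,
where `S` is one of `(-∞, 0)`, `(0, 1)`, `(1, ∞)` and `x` is in another one of these intervals,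
under the constraint that `A`, `B`, `C` have positive real parts. The number `D` will be the lower
parameter of the hypergeometric function in `g`, so it must not be a non-positive integer. The
integral converges absolutely. If `μ` is a positive integer, then `Γ(1 - μ)` is a pole, for which
Mathlib's value `0` gives, correctly, `1 / Γ(1 - μ) = 0`. -/
def StieltjesFormula (S : Set ℝ) (μ : ℂ) (f g : ℝ → ℂ) (A B C D : ℂ) : Prop :=
  0 < A.re → 0 < B.re → 0 < C.re → (∀ n : ℕ, D ≠ -(n : ℂ)) →
    ∀ x ∈ (Iio (0 : ℝ) ∪ Ioo 0 1 ∪ Ioi 1) \ S,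
      IntegrableOn (fun y : ℝ => f y * absPow (x - y) (μ - 1)) S ∧
      ∫ y in S, f y * absPow (x - y) (μ - 1) =
        Complex.Gamma A * Complex.Gamma B * Complex.Gamma C /
          (Complex.Gamma D * Complex.Gamma (1 - μ)) * g x

end

end GaussStieltjes

open GaussStieltjes

/-! All 24 formulas are one integral evaluation seen through the symmetries of the singular points
0, 1, ∞. The core is `integral_betaGaussKernel_mul`: for w < 1, the integral over (0,1) of y^(δ-1)
(1-y)^(γ-1) F(α,β;γ;1-y) (1-wy)^(-σ), with σ = δ+γ-α, is a constant times F(δ, δ+γ-α-β; δ+γ-β; w).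

At w = 0, expanding F in powers of 1-y gives beta integrals that add up to a multiple of
F(α,β;γ+δ;1), which Gauss's theorem (`tsum_gaussCoeff`) turns into a quotient of Gamma values.
Replacing δ by δ+n gives the moments of the kernel. In the binomial expansion of (1-wy)^(-σ), the
factor (σ)_n cancels against the n-th moment and a Gauss series in w remains. This settles |w| < 1;
both sides are real-analytic on w < 1, so the identity theorem does the rest.

With w = 1/x and σ = 1-μ this is a Stieltjes transform on (0,1). The maps y ↦ 1-y and y ↦ 1/y
permute the intervals, and together with Pfaff's transformation they produce six base forms, one for
each interval and admissible argument. Each of the 24 formulas is a base form, up to Euler's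
transformation and exchange of the upper parameters.

Since `gaussF` is selected by `Classical.epsilon`, the existence of the continuation needs proof.
Pfaff's transformation near 0, a rearranged double series with Chu–Vandermonde, gives an expression
analytic on (-∞, 1/2) that is glued to the Gauss series (`exists_isGaussContinuation`). -/

namespace GaussStieltjes

open Filter Topology Finset
open scoped Nat

/-! ### Rising factorials and their growth. -/

/-- The rising factorial `a (a + 1) ⋯ (a + n - 1)`. -/
noncomputable def poch (a : ℂ) (n : ℕ) : ℂ := (ascPochhammer ℂ n).eval a

@[simp] lemma poch_zero (a : ℂ) : poch a 0 = 1 := by simp [poch]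

lemma poch_succ (a : ℂ) (n : ℕ) : poch a (n + 1) = poch a n * (a + n) :=
  ascPochhammer_succ_eval n a

lemma poch_eq_prod (a : ℂ) (n : ℕ) : poch a n = ∏ j ∈ range n, (a + j) := by
  induction n with
  | zero => simp
  | succ n ih => rw [poch_succ, ih, prod_range_succ]

lemma poch_add (a : ℂ) (m n : ℕ) : poch a (m + n) = poch a m * poch (a + m) n := by
  rw [poch_eq_prod, poch_eq_prod, poch_eq_prod, prod_range_add]
  congr 1
  refine prod_congr rfl fun j _ => ?_
  push_cast
  ring

lemma poch_succ_left (a : ℂ) (n : ℕ) : poch a (n + 1) = a * poch (a + 1) n := by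
  rw [add_comm, poch_add]
  simp [poch_succ]

lemma poch_ne_zero {a : ℂ} (ha : ∀ n : ℕ, a ≠ -(n : ℂ)) (n : ℕ) : poch a n ≠ 0 := by
  rw [poch_eq_prod, prod_ne_zero_iff]
  exact fun j _ h => ha j (eq_neg_of_add_eq_zero_left h)

/-- For a nonnegative real parameter the norm of the rising factorial is the rising factorial
itself, so this bound leads to binomial series with a closed-form sum. The shift k stays outside the
norm to keep that sum sharp enough in `ordinaryHypergeometric_pfaff`. -/
lemma norm_poch_le (a : ℂ) (k n : ℕ) : ‖poch (a + k) n‖ ≤ ‖poch ((‖a‖ + k : ℝ) : ℂ) n‖ := by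
  rw [poch_eq_prod, poch_eq_prod, norm_prod, norm_prod]
  refine prod_le_prod (fun _ _ => norm_nonneg _) fun j _ => ?_
  have h : (((‖a‖ + k : ℝ) : ℂ) + j) = ((‖a‖ + k + j : ℝ) : ℂ) := by push_cast; ring
  rw [h, Complex.norm_real, Real.norm_of_nonneg (by positivity)]
  refine (norm_add_le _ _).trans ?_
  gcongr
  · refine (norm_add_le _ _).trans ?_
    simp
  · simp

/-- Euler's limit for Γ thereby controls the growth of rising factorials. At a pole both sides
vanish, by the convention for division by zero. -/
lemma poch_succ_eq_GammaSeq (a : ℂ) {n : ℕ} (hn : n ≠ 0) :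
    poch a (n + 1) = (n : ℂ) ^ a * n ! * (Complex.GammaSeq a n)⁻¹ := by
  have h1 : (n : ℂ) ^ a ≠ 0 := by
    rw [Ne, Complex.cpow_eq_zero_iff]
    simp [hn]
  have h2 : (n ! : ℂ) ≠ 0 := by exact_mod_cast n.factorial_ne_zero
  rw [Complex.GammaSeq, ← poch_eq_prod, inv_div]
  field_simp

lemma norm_natCast_cpow (a : ℂ) {n : ℕ} (hn : n ≠ 0) : ‖(n : ℂ) ^ a‖ = (n : ℝ) ^ a.re := by
  have := Complex.norm_cpow_eq_rpow_re_of_pos (x := (n : ℝ)) (by positivity) a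
  simpa using this

lemma tendsto_GammaSeq_inv (a : ℂ) :
    Tendsto (fun n => (Complex.GammaSeq a n)⁻¹) atTop (𝓝 (Complex.Gamma a)⁻¹) := by
  -- `Complex.Gamma` takes the value 0 exactly at the poles -m. There `GammaSeq` has a zero
  -- denominator for n ≥ m and is 0 too, so the limit is the entire function 1/Γ everywhere.
  by_cases h : Complex.Gamma a = 0
  · obtain ⟨m, rfl⟩ := (Complex.Gamma_eq_zero_iff a).1 h
    rw [h, inv_zero]
    refine tendsto_const_nhds.congr' ?_
    filter_upwards [eventually_ge_atTop m] with n hn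
    rw [Complex.GammaSeq, prod_eq_zero (i := m) (by simp; omega) (by simp)]
    simp
  · exact (Complex.GammaSeq_tendsto_Gamma a).inv₀ h

lemma exists_norm_poch_le (a : ℂ) :
    ∃ K : ℝ, 0 ≤ K ∧ ∀ n : ℕ, n ≠ 0 → ‖poch a (n + 1)‖ ≤ K * ((n : ℝ) ^ a.re * n !) := by
  obtain ⟨K, hK⟩ := (tendsto_GammaSeq_inv a).norm.bddAbove_range
  have hK' : ∀ n, ‖(Complex.GammaSeq a n)⁻¹‖ ≤ K := fun n => hK ⟨n, rfl⟩
  refine ⟨K, (norm_nonneg _).trans (hK' 0), fun n hn => ?_⟩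
  rw [poch_succ_eq_GammaSeq a hn, norm_mul, norm_mul, norm_natCast_cpow a hn, mul_comm K]
  have : ‖(n ! : ℂ)‖ = n ! := by simp
  rw [this]
  gcongr
  exact hK' n

lemma exists_norm_poch_inv_le (a : ℂ) :
    ∃ K : ℝ, 0 ≤ K ∧ ∀ n : ℕ, n ≠ 0 → ‖(poch a (n + 1))⁻¹‖ ≤ K * ((n : ℝ) ^ (-a.re) * (n ! : ℝ)⁻¹) := by
  obtain ⟨K, hK⟩ := (Complex.GammaSeq_tendsto_Gamma a).norm.bddAbove_range
  have hK' : ∀ n, ‖Complex.GammaSeq a n‖ ≤ K := fun n => hK ⟨n, rfl⟩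
  refine ⟨K, (norm_nonneg _).trans (hK' 0), fun n hn => ?_⟩
  rw [poch_succ_eq_GammaSeq a hn, mul_inv, mul_inv, inv_inv, norm_mul, norm_mul, norm_inv, norm_inv,
    norm_natCast_cpow a hn, mul_comm K, Real.rpow_neg (by positivity)]
  have : ‖(n ! : ℂ)‖ = n ! := by simp
  rw [this]
  gcongr
  exact hK' n

/-! ### The Gauss series: coefficient bounds and analyticity on the unit disc. -/

/-- The Taylor coefficients of the Gauss series. -/
noncomputable def gaussCoeff (a b c : ℂ) (n : ℕ) : ℂ := poch a n * poch b n / (poch c n * n !)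

lemma exists_norm_gaussCoeff_le (a b c : ℂ) :
    ∃ K : ℝ, 0 ≤ K ∧ ∀ n : ℕ, n ≠ 0 →
      ‖gaussCoeff a b c (n + 1)‖ ≤ K * (n : ℝ) ^ (a.re + b.re - c.re - 1) := by
  obtain ⟨Ka, ha0, ha⟩ := exists_norm_poch_le a
  obtain ⟨Kb, hb0, hb⟩ := exists_norm_poch_le b
  obtain ⟨Kc, hc0, hc⟩ := exists_norm_poch_inv_le c
  refine ⟨Ka * Kb * Kc, by positivity, fun n hn => ?_⟩
  have hn' : (0 : ℝ) < n := by positivity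
  have hf : (0 : ℝ) < n ! := by positivity
  have key : ‖gaussCoeff a b c (n + 1)‖ =
      ‖poch a (n + 1)‖ * ‖poch b (n + 1)‖ * ‖(poch c (n + 1))⁻¹‖ * ((n + 1) ! : ℝ)⁻¹ := by
    rw [gaussCoeff, div_eq_mul_inv, mul_inv, norm_mul, norm_mul, norm_mul, norm_inv (((n + 1) ! : ℕ) : ℂ)]
    simp [mul_assoc]
  rw [key]
  calc _ ≤ (Ka * ((n : ℝ) ^ a.re * n !)) * (Kb * ((n : ℝ) ^ b.re * n !)) *
        (Kc * ((n : ℝ) ^ (-c.re) * (n ! : ℝ)⁻¹)) * ((n : ℝ)⁻¹ * (n ! : ℝ)⁻¹) := by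
        gcongr
        · exact ha n hn
        · exact hb n hn
        · exact hc n hn
        -- The factor (n+1)! in the denominator, against n! in the bounds for the rising factorials,
        -- yields the -1 in the exponent.
        · rw [Nat.factorial_succ, Nat.cast_mul, mul_inv]
          gcongr
          simp
    _ = _ := by
        rw [show a.re + b.re - c.re - 1 = a.re + b.re + -c.re + -1 by ring, Real.rpow_add hn',
          Real.rpow_add hn', Real.rpow_add hn', Real.rpow_neg_one]
        field_simp

lemma hasSum_binomial (s : ℂ) {x : ℂ} (hx : ‖x‖ < 1) :
    HasSum (fun n => poch s n / n ! * x ^ n) ((1 - x) ^ (-s)) := by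
  have h := (Complex.one_div_one_sub_cpow_hasFPowerSeriesOnBall_zero s).hasSum (y := x)
    (by simpa [Metric.mem_eball, edist_zero_right, ← ofReal_norm] using hx)
  rw [zero_add, one_div, ← Complex.cpow_neg] at h
  refine h.congr_fun fun n => ?_
  rw [FormalMultilinearSeries.ofScalars_apply_eq, smul_eq_mul, Ring.choose_eq_smul,
    Polynomial.descPochhammer_smeval_eq_ascPochhammer, Polynomial.ascPochhammer_smeval_cast,
    Polynomial.ascPochhammer_smeval_eq_eval, poch, smul_eq_mul, div_eq_inv_mul]
  congr 4
  ring

lemma summable_norm_gaussCoeff (a b c : ℂ) {r : ℝ} (h0 : 0 ≤ r) (hr : r < 1) :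
    Summable fun n => ‖gaussCoeff a b c n‖ * r ^ n := by
  obtain ⟨K, hK0, hK⟩ := exists_norm_gaussCoeff_le a b c
  set e : ℕ := ⌈a.re + b.re - c.re - 1⌉₊
  -- The coefficient bound concerns index n + 1 with n ≠ 0, so the first two terms are dropped.
  rw [← summable_nat_add_iff 2]
  refine Summable.of_nonneg_of_le (fun n => by positivity) (fun n => ?_)
    (((summable_nat_add_iff 1).2 (summable_pow_mul_geometric_of_norm_lt_one e
      (r := r) (by rwa [Real.norm_of_nonneg h0]))).mul_left K)
  have hn : (1 : ℝ) ≤ ((n + 1 : ℕ) : ℝ) := by simp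
  calc _ ≤ K * ((n + 1 : ℕ) : ℝ) ^ (e : ℝ) * r ^ (n + 2) := by
        gcongr
        refine (hK (n + 1) (by simp)).trans ?_
        gcongr
        exact Nat.le_ceil _
    _ ≤ _ := by
        rw [Real.rpow_natCast, mul_assoc]
        exact mul_le_mul_of_nonneg_left (mul_le_mul_of_nonneg_left
          (pow_le_pow_of_le_one h0 hr.le (by omega)) (by positivity)) hK0

lemma ordinaryHypergeometric_eq_tsum_gaussCoeff (a b c x : ℂ) :
    ordinaryHypergeometric a b c x = ∑' n, gaussCoeff a b c n * x ^ n := by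
  rw [ordinaryHypergeometric_eq_tsum]
  refine tsum_congr fun n => ?_
  simp only [gaussCoeff, poch, smul_eq_mul, div_eq_mul_inv, mul_inv]
  ring

lemma hasSum_ordinaryHypergeometric (a b c : ℂ) {x : ℂ} (hx : ‖x‖ < 1) :
    HasSum (fun n => gaussCoeff a b c n * x ^ n) (ordinaryHypergeometric a b c x) := by
  rw [ordinaryHypergeometric_eq_tsum_gaussCoeff]
  refine (Summable.of_norm ?_).hasSum
  simpa using summable_norm_gaussCoeff a b c (norm_nonneg x) hx

lemma analyticOnNhd_ordinaryHypergeometric (a b c : ℂ) :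
    AnalyticOnNhd ℂ (ordinaryHypergeometric a b c) (Metric.ball (0 : ℂ) 1) := by
  have hr : 1 ≤ (ordinaryHypergeometricSeries ℂ a b c).radius := by
    refine ENNReal.le_of_forall_nnreal_lt fun r hr => ?_
    refine (ordinaryHypergeometricSeries ℂ a b c).le_radius_of_summable_norm ?_
    have := summable_norm_gaussCoeff a b c (r := r) r.2 (by exact_mod_cast hr)
    refine this.congr fun n => ?_
    rw [ordinaryHypergeometricSeries, FormalMultilinearSeries.ofScalars_norm]
    simp only [gaussCoeff, poch, div_eq_mul_inv, mul_inv]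
    congr 2
    ring
  have h := ((ordinaryHypergeometricSeries ℂ a b c).hasFPowerSeriesOnBall
    (lt_of_lt_of_le zero_lt_one hr)).mono zero_lt_one hr
  have h2 : AnalyticOnNhd ℂ (ordinaryHypergeometric a b c) (Metric.eball (0 : ℂ) 1) := h.analyticOnNhd
  rw [show Metric.eball (0 : ℂ) 1 = Metric.ball 0 1 by
    rw [← ENNReal.ofReal_one, Metric.eball_ofReal]] at h2
  exact h2

lemma hasSum_norm_binomial {s r : ℝ} (hs : 0 ≤ s) (h0 : 0 ≤ r) (hr : r < 1) :
    HasSum (fun n => ‖poch (s : ℂ) n‖ / n ! * r ^ n) ((1 - r) ^ (-s)) := by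
  have h := hasSum_binomial (s : ℂ) (x := (r : ℂ)) (by simpa [abs_of_nonneg h0] using hr)
  have hp : ∀ n, poch (s : ℂ) n = ((‖poch (s : ℂ) n‖ : ℝ) : ℂ) := by
    intro n
    rw [poch_eq_prod, norm_prod, Complex.ofReal_prod]
    refine prod_congr rfl fun j _ => ?_
    have : (s : ℂ) + j = ((s + j : ℝ) : ℂ) := by push_cast; rfl
    rw [this, Complex.norm_real, Real.norm_of_nonneg (by positivity)]
  rw [← Complex.hasSum_ofReal]
  convert h using 1
  · funext n
    rw [hp n]
    simp
  · rw [Complex.ofReal_cpow (by linarith)]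
    simp

/-! ### Chu–Vandermonde and Pfaff's transformation near the origin. -/

/-- The Chu–Vandermonde identity, in a form without division. -/
lemma sum_choose_poch (b c : ℂ) (n : ℕ) :
    ∑ k ∈ range (n + 1), (n.choose k : ℂ) * ((-1) ^ k * poch (c - b) k * poch (c + k) (n - k)) =
      poch b n := by
  induction n generalizing b c with
  | zero => simp
  | succ n ih =>
    have key := ih (b + 1) (c + 1)
    rw [poch_succ_left, ← key, mul_sum, sum_range_succ']
    -- Pascal's rule splits the sum for n + 1 into two sums weighted by n.choose k. The two terms
    -- with the same weight share a factor, and the remaining factors combine to (c+k) - (c-b+k) =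
    -- b.
    have h1 : ∀ k ∈ range (n + 1), (n.choose k : ℂ) * ((-1) ^ k * poch (c - b) k *
          poch (c + k) (n + 1 - k)) + (n.choose k : ℂ) * ((-1) ^ (k + 1) * poch (c - b) (k + 1) *
          poch (c + (k + 1 : ℕ)) (n + 1 - (k + 1))) =
        b * ((n.choose k : ℂ) * ((-1) ^ k * poch (c + 1 - (b + 1)) k *
          poch (c + 1 + k) (n - k))) := by
      intro k hk
      have hk' : k ≤ n := by simpa [Nat.lt_succ_iff] using hk
      rw [show n + 1 - k = n - k + 1 by omega, poch_succ_left, poch_succ, Nat.add_sub_add_right,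
        show c + k + 1 = c + 1 + k by ring, show c + ((k + 1 : ℕ) : ℂ) = c + 1 + k by push_cast; ring,
        show c + 1 - (b + 1) = c - b by ring]
      ring
    rw [← sum_congr rfl h1, sum_add_distrib]
    have h2 : ∀ k ∈ range (n + 1), ((n + 1).choose (k + 1) : ℂ) * ((-1) ^ (k + 1) *
          poch (c - b) (k + 1) * poch (c + (k + 1 : ℕ)) (n + 1 - (k + 1))) =
        (n.choose k : ℂ) * ((-1) ^ (k + 1) * poch (c - b) (k + 1) *
          poch (c + (k + 1 : ℕ)) (n + 1 - (k + 1))) +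
        (n.choose (k + 1) : ℂ) * ((-1) ^ (k + 1) * poch (c - b) (k + 1) *
          poch (c + (k + 1 : ℕ)) (n + 1 - (k + 1))) := by
      intro k _
      rw [Nat.choose_succ_succ]
      push_cast
      ring
    rw [sum_congr rfl h2, sum_add_distrib, add_assoc, add_comm]
    congr 1
    rw [sum_range_succ, sum_range_succ' _ n, Nat.choose_succ_self]
    simp

/-- The left side is the coefficient of x^n in (1-x)^(-a) F(a,c-b;c;x/(x-1)). Since (a)_k
(a+k)_(n-k) = (a)_n, it reduces to Chu–Vandermonde. -/
lemma sum_gaussCoeff_mul_poch (a b : ℂ) {c : ℂ} (hc : ∀ n : ℕ, c ≠ -(n : ℂ)) (n : ℕ) :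
    ∑ k ∈ range (n + 1), (-1) ^ k * gaussCoeff a (c - b) c k * (poch (a + k) (n - k) / (n - k) !) =
      gaussCoeff a b c n := by
  have hf : ∀ m : ℕ, (m ! : ℂ) ≠ 0 := fun m => by exact_mod_cast m.factorial_ne_zero
  have hn := poch_ne_zero hc n
  rw [gaussCoeff, ← sum_choose_poch b c n, eq_div_iff (mul_ne_zero hn (hf n)), sum_mul, mul_sum]
  refine sum_congr rfl fun k hk => ?_
  have hk' : k ≤ n := by simpa [Nat.lt_succ_iff] using hk
  have e1 : poch a n = poch a k * poch (a + k) (n - k) := by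
    rw [← poch_add, Nat.add_sub_cancel' hk']
  have e2 : poch c n = poch c k * poch (c + k) (n - k) := by
    rw [← poch_add, Nat.add_sub_cancel' hk']
  have e3 : ((n.choose k : ℕ) : ℂ) * k ! * (n - k)! = n ! := by
    exact_mod_cast Nat.choose_mul_factorial_mul_factorial hk'
  have hk0 := poch_ne_zero hc k
  have := hf k
  have := hf (n - k)
  rw [e1, e2, gaussCoeff, ← e3]
  field_simp

/-- Pfaff's transformation near the origin. -/
lemma ordinaryHypergeometric_pfaff (a b : ℂ) {c : ℂ} (hc : ∀ n : ℕ, c ≠ -(n : ℂ)) {x : ℂ}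
    (hx : ‖x‖ < 1 / 2) :
    (1 - x) ^ (-a) * ordinaryHypergeometric a (c - b) c (x / (x - 1)) =
      ordinaryHypergeometric a b c x := by
  have hx1 : (1 - x) ≠ 0 := by
    intro h
    rw [← sub_eq_zero.1 h, norm_one] at hx
    norm_num at hx
  have hq : ‖x / (x - 1)‖ < 1 := by
    rw [norm_div, div_lt_one (by rw [norm_pos_iff, ← neg_ne_zero, neg_sub]; exact hx1),
      norm_sub_rev]
    have := norm_sub_norm_le 1 x
    rw [norm_one] at this
    linarith
  -- Row k is the k-th term of the series in x/(x-1), with (1-x)^(-a-k) expanded in powers of x.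
  -- Summing along antidiagonals instead gives the right side.
  set f : ℕ × ℕ → ℂ := fun p => (-1) ^ p.1 * gaussCoeff a (c - b) c p.1 *
    (poch (a + p.1) p.2 / p.2 !) * x ^ (p.1 + p.2)
  have hrow : ∀ k, HasSum (fun m => f (k, m))
      ((1 - x) ^ (-a) * (gaussCoeff a (c - b) c k * (x / (x - 1)) ^ k)) := by
    intro k
    have h := (hasSum_binomial (a + k) (x := x) (by linarith)).mul_left
      ((-1) ^ k * gaussCoeff a (c - b) c k * x ^ k)
    have e : (-1) ^ k * gaussCoeff a (c - b) c k * x ^ k * (1 - x) ^ (-(a + k)) =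
        (1 - x) ^ (-a) * (gaussCoeff a (c - b) c k * (x / (x - 1)) ^ k) := by
      rw [neg_add, Complex.cpow_add _ _ hx1, Complex.cpow_neg _ (k : ℂ), Complex.cpow_natCast,
        show x / (x - 1) = (-1) * x * (1 - x)⁻¹ by
          rw [← neg_sub 1 x, div_neg, div_eq_mul_inv]; ring, mul_pow, mul_pow, inv_pow]
      ring
    rw [e] at h
    refine h.congr_fun fun m => ?_
    simp only [f]
    rw [pow_add]
    ring
  have hsum : Summable f := by
    refine Summable.of_norm ?_
    have hrow' : ∀ k : ℕ, HasSum (fun m => ‖gaussCoeff a (c - b) c k‖ * ‖x‖ ^ k *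
        (‖poch ((‖a‖ + k : ℝ) : ℂ) m‖ / m ! * ‖x‖ ^ m))
        (‖gaussCoeff a (c - b) c k‖ * ‖x‖ ^ k * (1 - ‖x‖) ^ (-(‖a‖ + k))) := fun k =>
      (hasSum_norm_binomial (by positivity) (norm_nonneg x) (by linarith)).mul_left _
    have hle : ∀ k m, ‖f (k, m)‖ ≤ ‖gaussCoeff a (c - b) c k‖ * ‖x‖ ^ k *
        (‖poch ((‖a‖ + k : ℝ) : ℂ) m‖ / m ! * ‖x‖ ^ m) := by
      intro k m
      have e : ‖f (k, m)‖ = ‖gaussCoeff a (c - b) c k‖ * ‖x‖ ^ k *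
          (‖poch (a + k) m‖ / m ! * ‖x‖ ^ m) := by
        simp only [f, norm_mul, norm_div, norm_pow, norm_neg, norm_one, one_pow, pow_add,
          Complex.norm_natCast]
        ring
      rw [e]
      gcongr
      exact norm_poch_le a k m
    have hs : ∀ k, Summable fun m => ‖f (k, m)‖ := fun k =>
      Summable.of_nonneg_of_le (fun _ => norm_nonneg _) (hle k) (hrow' k).summable
    refine (summable_prod_of_nonneg fun _ => norm_nonneg _).2 ⟨hs, ?_⟩
    -- The norms in row k sum to at most a constant times the k-th coefficient's norm times
    -- (|x|/(1-|x|))^k. This is where |x| < 1/2 is needed.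
    have hr : ‖x‖ / (1 - ‖x‖) < 1 := by
      rw [div_lt_one (by linarith)]
      linarith
    refine Summable.of_nonneg_of_le (fun k => tsum_nonneg fun _ => norm_nonneg _)
      (fun k => ((hs k).tsum_le_tsum (hle k) (hrow' k).summable).trans_eq (hrow' k).tsum_eq) ?_
    refine ((summable_norm_gaussCoeff a (c - b) c (r := ‖x‖ / (1 - ‖x‖))
      (div_nonneg (norm_nonneg x) (by linarith)) hr).mul_left ((1 - ‖x‖) ^ (-‖a‖))).congr fun k => ?_
    rw [neg_add, Real.rpow_add (by linarith), Real.rpow_neg (by linarith) (k : ℝ), Real.rpow_natCast,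
      div_pow, div_eq_mul_inv]
    ring
  have h1 := hsum.hasSum.prod_fiberwise hrow
  have h2 := ((hasSum_ordinaryHypergeometric a (c - b) c hq).mul_left ((1 - x) ^ (-a))).unique h1
  rw [h2, ordinaryHypergeometric_eq_tsum_gaussCoeff,
    ← HasAntidiagonal.sigmaAntidiagonalEquivProd.tsum_eq f,
    ((HasAntidiagonal.sigmaAntidiagonalEquivProd (A := ℕ)).summable_iff.2 hsum).tsum_sigma'
      (f := fun p => f (HasAntidiagonal.sigmaAntidiagonalEquivProd p))
      (fun n => (hasSum_fintype _).summable)]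
  refine tsum_congr fun n => ?_
  rw [tsum_fintype, ← sum_gaussCoeff_mul_poch a b hc n, sum_mul,
    ← Nat.sum_antidiagonal_eq_sum_range_succ (fun k m =>
      (-1) ^ k * gaussCoeff a (c - b) c k * (poch (a + k) m / m !) * x ^ n),
    ← Finset.sum_coe_sort (antidiagonal n)]
  refine Finset.sum_congr rfl fun p _ => ?_
  obtain ⟨⟨k, m⟩, hp⟩ := p
  obtain rfl := mem_antidiagonal.1 hp
  rfl

/-! ### Continuation to (-∞, 1), with the Pfaff and Euler transformations. -/

lemma analyticAt_ofReal_comp {f : ℂ → ℂ} {x : ℝ} (hf : AnalyticAt ℂ f x) :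
    AnalyticAt ℝ (fun y : ℝ => f y) x :=
  (hf.restrictScalars (𝕜 := ℝ)).comp (f := fun y : ℝ => (y : ℂ)) (Complex.ofRealCLM.analyticAt x)

lemma analyticAt_ordinaryHypergeometric_ofReal (a b c : ℂ) {x : ℝ} (hx : |x| < 1) :
    AnalyticAt ℝ (fun y : ℝ => ordinaryHypergeometric a b c (y : ℂ)) x :=
  analyticAt_ofReal_comp (analyticOnNhd_ordinaryHypergeometric a b c x (by simpa using hx))

lemma analyticAt_one_sub_cpow (s : ℂ) {x : ℝ} (hx : x < 1) :
    AnalyticAt ℝ (fun y : ℝ => (1 - (y : ℂ)) ^ s) x := by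
  refine analyticAt_ofReal_comp (f := fun z => (1 - z) ^ s) ?_
  refine (analyticAt_const.sub analyticAt_id).cpow analyticAt_const ?_
  left
  simpa using hx

lemma analyticAt_div_sub_one {x : ℝ} (hx : x < 1) : AnalyticAt ℝ (fun y : ℝ => y / (y - 1)) x :=
  analyticAt_id.div (analyticAt_id.sub analyticAt_const) (sub_ne_zero.2 hx.ne)

lemma div_sub_one_lt_one {x : ℝ} (hx : x < 1) : x / (x - 1) < 1 := by
  rw [div_lt_one_of_neg (by linarith)]
  linarith

lemma abs_div_sub_one_lt_one {x : ℝ} (hx : x < 1 / 2) : |x / (x - 1)| < 1 := by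
  rw [abs_lt]
  refine ⟨?_, div_sub_one_lt_one (by linarith)⟩
  rw [lt_div_iff_of_neg (by linarith)]
  linarith

/-- For x < 1/2 the Pfaff variable x/(x-1) lies in (-1,1), so the Pfaff side is analytic on (-∞,
1/2). It agrees with the Gauss series near 0, hence on the overlap (-1, 1/2), and the two are glued.
-/
lemma exists_isGaussContinuation (a b : ℂ) {c : ℂ} (hc : ∀ n : ℕ, c ≠ -(n : ℂ)) :
    ∃ f, IsGaussContinuation a b c f := by
  set P : ℝ → ℂ := fun x => (1 - (x : ℂ)) ^ (-a) *
    ordinaryHypergeometric a (c - b) c ((x / (x - 1) : ℝ) : ℂ)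
  set F : ℝ → ℂ := fun x => ordinaryHypergeometric a b c (x : ℂ)
  have hP : AnalyticOnNhd ℝ P (Iio (1 / 2)) := fun x hx =>
    (analyticAt_one_sub_cpow (-a) (by linarith [mem_Iio.1 hx])).mul
      ((analyticAt_ordinaryHypergeometric_ofReal a (c - b) c (abs_div_sub_one_lt_one hx)).comp
        (f := fun y : ℝ => y / (y - 1)) (analyticAt_div_sub_one (by linarith [mem_Iio.1 hx])))
  have hF : AnalyticOnNhd ℝ F (Ioo (-1) 1) := fun x hx =>
    analyticAt_ordinaryHypergeometric_ofReal a b c (abs_lt.2 hx)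
  have hPF : EqOn P F (Ioo (-1) (1 / 2)) := by
    refine (hP.mono Ioo_subset_Iio_self).eqOn_of_preconnected_of_eventuallyEq
      (hF.mono (Ioo_subset_Ioo_right (by norm_num))) isPreconnected_Ioo (z₀ := 0) (by simp) ?_
    filter_upwards [Ioo_mem_nhds (a := (-(1 / 2) : ℝ)) (b := 1 / 2) (by norm_num) (by norm_num)]
      with x hx
    have := ordinaryHypergeometric_pfaff a b hc (x := (x : ℂ)) (by simpa using abs_lt.2 hx)
    simp only [P, F, ← this]
    push_cast
    rfl
  refine ⟨fun x => if x < 1 / 2 then P x else F x, fun x hx => ?_, fun x hx => ?_⟩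
  · by_cases h : x < 1 / 2
    · refine (hP x h).congr ?_
      filter_upwards [Iio_mem_nhds h] with y hy
      exact (if_pos hy).symm
    · refine (hF x ⟨by linarith, hx⟩).congr ?_
      filter_upwards [Ioi_mem_nhds (show -1 < x by linarith)] with y hy
      split_ifs with hy2
      · exact (hPF ⟨hy, hy2⟩).symm
      · rfl
  · dsimp only
    split_ifs with h
    · exact hPF ⟨(abs_lt.1 hx).1, h⟩
    · rfl

lemma isGaussContinuation_gaussF (a b : ℂ) {c : ℂ} (hc : ∀ n : ℕ, c ≠ -(n : ℂ)) :
    IsGaussContinuation a b c (gaussF a b c) :=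
  Classical.epsilon_spec (exists_isGaussContinuation a b hc)

/-- Identity theorem on the connected set (-∞, 1). The radius r is free because Pfaff's formula is
available as a series identity only for |x| < 1/2. -/
lemma IsGaussContinuation.eqOn {a b c : ℂ} {f g : ℝ → ℂ} (hf : IsGaussContinuation a b c f)
    (hg : AnalyticOnNhd ℝ g (Iio 1)) {r : ℝ} (hr : 0 < r)
    (h : ∀ x : ℝ, |x| < r → g x = ordinaryHypergeometric a b c (x : ℂ)) :
    EqOn f g (Iio 1) := by
  refine hf.1.eqOn_of_preconnected_of_eventuallyEq hg isPreconnected_Iio (z₀ := 0) (by simp) ?_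
  filter_upwards [Ioo_mem_nhds (neg_neg_of_pos (lt_min hr one_pos)) (lt_min hr one_pos)] with x hx
  have hx' := lt_min_iff.1 (abs_lt.2 hx)
  rw [hf.2 x hx'.2, h x hx'.1]

/-- The predicates given to `Classical.epsilon` are equal, so the chosen functions are equal; no
condition on c is required. -/
lemma gaussF_comm (a b c : ℂ) : gaussF a b c = gaussF b a c := by
  unfold gaussF IsGaussContinuation ordinaryHypergeometric
  simp only [ordinaryHypergeometricSeries_symm (𝔸 := ℂ) a b c]

/-- Pfaff's transformation. -/
lemma gaussF_pfaff (a b : ℂ) {c : ℂ} (hc : ∀ n : ℕ, c ≠ -(n : ℂ)) {x : ℝ} (hx : x < 1) :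
    gaussF a b c x = absPow (1 - x) (-a) * gaussF a (c - b) c (x / (x - 1)) := by
  have h2 := isGaussContinuation_gaussF a (c - b) hc
  have key := (isGaussContinuation_gaussF a b hc).eqOn
    (g := fun x => (1 - (x : ℂ)) ^ (-a) * gaussF a (c - b) c (x / (x - 1)))
    (fun x hx => (analyticAt_one_sub_cpow (-a) hx).mul ((h2.1 _ (div_sub_one_lt_one hx)).comp
      (f := fun y : ℝ => y / (y - 1)) (analyticAt_div_sub_one hx))) (r := 1 / 2) (by norm_num)
    (fun x hx => by
      have := ordinaryHypergeometric_pfaff a b hc (x := (x : ℂ)) (by simpa using hx)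
      rw [h2.2 _ (abs_div_sub_one_lt_one (abs_lt.1 hx).2), ← this]
      push_cast
      rfl) hx
  rw [key, absPow, abs_of_pos (by linarith)]
  push_cast
  rfl

lemma absPow_add {t : ℝ} (ht : t ≠ 0) (p q : ℂ) : absPow t (p + q) = absPow t p * absPow t q :=
  Complex.cpow_add _ _ (by simpa using ht)

@[simp] lemma absPow_zero (t : ℝ) : absPow t 0 = 1 := by simp [absPow]

lemma absPow_mul (s t : ℝ) (p : ℂ) : absPow (s * t) p = absPow s p * absPow t p := by
  rw [absPow, abs_mul, Complex.ofReal_mul,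
    Complex.mul_cpow_ofReal_nonneg (abs_nonneg s) (abs_nonneg t)]
  rfl

lemma absPow_inv (t : ℝ) (p : ℂ) : absPow t⁻¹ p = absPow t (-p) := by
  rw [absPow, absPow, abs_inv, Complex.ofReal_inv, Complex.inv_cpow, Complex.cpow_neg]
  rw [Complex.arg_ofReal_of_nonneg (abs_nonneg t)]
  exact Real.pi_pos.ne

lemma absPow_neg_left (t : ℝ) (p : ℂ) : absPow (-t) p = absPow t p := by rw [absPow, abs_neg, absPow]

lemma absPow_sub_comm (s t : ℝ) (p : ℂ) : absPow (s - t) p = absPow (t - s) p := by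
  rw [← absPow_neg_left, neg_sub]

lemma norm_absPow {t : ℝ} (ht : t ≠ 0) (p : ℂ) : ‖absPow t p‖ = |t| ^ p.re :=
  Complex.norm_cpow_eq_rpow_re_of_pos (abs_pos.2 ht) p

/-- Euler's transformation. -/
lemma gaussF_euler (a b : ℂ) {c : ℂ} (hc : ∀ n : ℕ, c ≠ -(n : ℂ)) {x : ℝ} (hx : x < 1) :
    gaussF a b c x = absPow (1 - x) (c - a - b) * gaussF (c - a) (c - b) c x := by
  have hx0 : 1 - x ≠ 0 := by linarith
  have e1 : 1 - x / (x - 1) = (1 - x)⁻¹ := by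
    have : x - 1 ≠ 0 := by linarith
    field_simp
    ring
  have e2 : x / (x - 1) / (x / (x - 1) - 1) = x := by
    have : x - 1 ≠ 0 := by linarith
    rw [show x / (x - 1) - 1 = (x - 1)⁻¹ by field_simp; ring]
    field_simp
  -- Pfaff is applied twice, keeping first a and then c - b. The variable returns to x because x ↦
  -- x/(x-1) is an involution.
  rw [gaussF_pfaff a b hc hx, gaussF_comm a, gaussF_pfaff (c - b) a hc (div_sub_one_lt_one hx), e1,
    e2, absPow_inv, gaussF_comm (c - b), ← mul_assoc, ← absPow_add hx0]
  congr 2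
  ring

lemma hasSum_gaussF (a b : ℂ) {c : ℂ} (hc : ∀ n : ℕ, c ≠ -(n : ℂ)) {x : ℝ} (hx : |x| < 1) :
    HasSum (fun n => gaussCoeff a b c n * (x : ℂ) ^ n) (gaussF a b c x) := by
  rw [(isGaussContinuation_gaussF a b hc).2 x hx]
  exact hasSum_ordinaryHypergeometric a b c (by simpa using hx)

/-! ### Gauss's summation theorem. -/

lemma summable_norm_gaussCoeff_mul_rpow (a b c : ℂ) {p : ℝ} (hp : a.re + b.re + p < c.re) :
    Summable fun n : ℕ => ‖gaussCoeff a b c (n + 2)‖ * ((n + 1 : ℕ) : ℝ) ^ p := by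
  obtain ⟨K, hK0, hK⟩ := exists_norm_gaussCoeff_le a b c
  refine Summable.of_nonneg_of_le (fun n => by positivity) (fun n => ?_)
    (((summable_nat_add_iff 1).2 (Real.summable_nat_rpow
      (p := a.re + b.re - c.re - 1 + p).2 (by linarith))).mul_left K)
  rw [Real.rpow_add (by positivity), ← mul_assoc]
  gcongr
  exact hK (n + 1) (by simp)

lemma summable_norm_gaussCoeff_one (a b c : ℂ) (h : a.re + b.re < c.re) :
    Summable fun n => ‖gaussCoeff a b c n‖ := by
  rw [← summable_nat_add_iff 2]
  simpa using summable_norm_gaussCoeff_mul_rpow a b c (p := 0) (by simpa using h)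

lemma tendsto_natCast_mul_gaussCoeff (a b c : ℂ) (h : a.re + b.re < c.re) :
    Tendsto (fun n : ℕ => (n : ℂ) * gaussCoeff a b c n) atTop (𝓝 0) := by
  obtain ⟨K, hK0, hK⟩ := exists_norm_gaussCoeff_le a b c
  rw [← tendsto_add_atTop_iff_nat 1]
  have h1 : Tendsto (fun n : ℕ => K * 2 * (n : ℝ) ^ (-(c.re - a.re - b.re))) atTop (𝓝 0) := by
    simpa using ((tendsto_rpow_neg_atTop (y := c.re - a.re - b.re) (by linarith)).comp
      tendsto_natCast_atTop_atTop).const_mul (K * 2)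
  refine squeeze_zero_norm' ?_ h1
  filter_upwards [eventually_ge_atTop 1] with n hn
  have hn' : (1 : ℝ) ≤ n := by exact_mod_cast hn
  have h0 : (0 : ℝ) < n := by linarith
  rw [norm_mul, Complex.norm_natCast]
  calc _ ≤ (2 * n) * (K * (n : ℝ) ^ (a.re + b.re - c.re - 1)) := by
        gcongr
        · push_cast; linarith
        · exact hK n (by omega)
    _ = _ := by
        rw [Real.rpow_sub h0, Real.rpow_one, show a.re + b.re - c.re = -(c.re - a.re - b.re) by ring]
        field_simp

lemma gaussCoeff_zero (a b c : ℂ) : gaussCoeff a b c 0 = 1 := by simp [gaussCoeff]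

lemma add_natCast_ne {c : ℂ} (hc : ∀ n : ℕ, c ≠ -(n : ℂ)) (m : ℕ) : ∀ n : ℕ, c + m ≠ -(n : ℂ) := by
  intro n h
  refine hc (m + n) ?_
  push_cast
  linear_combination h

/-- The difference of the two series telescopes, and its boundary term, a multiple of N times the
N-th coefficient, tends to 0 by `tendsto_natCast_mul_gaussCoeff`. -/
lemma tsum_gaussCoeff_add_one (a b : ℂ) {c : ℂ} (hc : ∀ n : ℕ, c ≠ -(n : ℂ))
    (h : a.re + b.re < c.re) :
    c * (c - a - b) * ∑' n, gaussCoeff a b c n =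
      (c - a) * (c - b) * ∑' n, gaussCoeff a b (c + 1) n := by
  have hu := (Summable.of_norm (summable_norm_gaussCoeff_one a b c h)).hasSum
  have hv := (Summable.of_norm (summable_norm_gaussCoeff_one a b (c + 1)
    (by simpa using h.trans (lt_add_one _)))).hasSum
  have hc' : ∀ n : ℕ, c + n ≠ 0 := fun n h => hc n (eq_neg_of_add_eq_zero_left h)
  have hv' : ∀ n, (c + n) * gaussCoeff a b (c + 1) n = c * gaussCoeff a b c n := by
    intro n
    have h1 := poch_ne_zero hc n
    have h2 : poch (c + 1) n ≠ 0 := poch_ne_zero (by simpa using add_natCast_ne hc 1) n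
    have h3 : poch c n * (c + n) = c * poch (c + 1) n := by rw [← poch_succ, poch_succ_left]
    have hf : (n ! : ℂ) ≠ 0 := by exact_mod_cast n.factorial_ne_zero
    rw [gaussCoeff, gaussCoeff]
    field_simp
    linear_combination poch a n * poch b n * h3
  have hu' : ∀ n : ℕ, ((n + 1 : ℕ) : ℂ) * (c + n) * gaussCoeff a b c (n + 1) =
      (a + n) * (b + n) * gaussCoeff a b c n := by
    intro n
    have h1 := poch_ne_zero hc n
    have h2 : (((n + 1 : ℕ)) : ℂ) ≠ 0 := by exact_mod_cast n.succ_ne_zero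
    have hf : (n ! : ℂ) ≠ 0 := by exact_mod_cast n.factorial_ne_zero
    have h4 := hc' n
    rw [gaussCoeff, gaussCoeff, poch_succ, poch_succ, poch_succ, Nat.factorial_succ, Nat.cast_mul]
    field_simp
  have hpart : ∀ N : ℕ, ∑ n ∈ range N, (c * (c - a - b) * gaussCoeff a b c n -
      (c - a) * (c - b) * gaussCoeff a b (c + 1) n) = -c * (N * gaussCoeff a b c N) := by
    intro N
    induction N with
    | zero => simp
    | succ N ih =>
      rw [sum_range_succ, ih]
      refine mul_left_cancel₀ (hc' N) ?_
      linear_combination (-(c - a) * (c - b)) * hv' N + c * hu' N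
  have h1 := ((hu.mul_left (c * (c - a - b))).sub (hv.mul_left ((c - a) * (c - b)))).tendsto_sum_nat
  simp only [hpart] at h1
  have h2 := (tendsto_natCast_mul_gaussCoeff a b c h).const_mul (-c)
  rw [mul_zero] at h2
  exact sub_eq_zero.1 (tendsto_nhds_unique h1 h2)

lemma poch_mul_tsum_gaussCoeff (a b : ℂ) {c : ℂ} (hc : ∀ n : ℕ, c ≠ -(n : ℂ))
    (h : a.re + b.re < c.re) (N : ℕ) :
    poch c N * poch (c - a - b) N * ∑' n, gaussCoeff a b c n =
      poch (c - a) N * poch (c - b) N * ∑' n, gaussCoeff a b (c + N) n := by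
  induction N with
  | zero => simp
  | succ N ih =>
    have h1 := tsum_gaussCoeff_add_one a b (add_natCast_ne hc N)
      (by simp only [Complex.add_re, Complex.natCast_re]; linarith [(Nat.cast_nonneg N : (0 : ℝ) ≤ N)])
    rw [poch_succ, poch_succ, poch_succ, poch_succ,
      show c + ((N + 1 : ℕ) : ℂ) = c + N + 1 by push_cast; ring]
    linear_combination (c + N) * (c - a - b + N) * ih + poch (c - a) N * poch (c - b) N * h1

lemma norm_poch_ge {s : ℝ} (hs : 0 ≤ s) {c : ℂ} (hc : s ≤ c.re) (n : ℕ) :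
    ‖poch (s : ℂ) n‖ ≤ ‖poch c n‖ := by
  rw [poch_eq_prod, poch_eq_prod, norm_prod, norm_prod]
  refine prod_le_prod (fun _ _ => norm_nonneg _) fun j _ => ?_
  have h : (s : ℂ) + j = ((s + j : ℝ) : ℂ) := by push_cast; rfl
  rw [h, Complex.norm_real, Real.norm_of_nonneg (by positivity)]
  refine le_trans ?_ (Complex.re_le_norm _)
  simpa using hc

lemma ofReal_ne_neg_natCast {s : ℝ} (hs : 0 < s) (n : ℕ) : (s : ℂ) ≠ -(n : ℂ) := by
  intro h
  have : s = -(n : ℝ) := by exact_mod_cast h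
  linarith [(Nat.cast_nonneg n : (0 : ℝ) ≤ n)]

/-- Each coefficient of positive index is O(1/Re(c+N)). Once Re(c+N) ≥ s, the coefficients with
lower parameter s dominate, so the limit passes through the sum. -/
lemma tendsto_tsum_gaussCoeff (a b c : ℂ) :
    Tendsto (fun N : ℕ => ∑' n, gaussCoeff a b (c + N) n) atTop (𝓝 1) := by
  -- Positivity of s keeps its rising factorials nonzero; s > Re(a+b) makes the dominating series
  -- converge at 1.
  obtain ⟨s, hs⟩ : ∃ s : ℝ, s = |a.re + b.re| + 1 := ⟨_, rfl⟩
  have hs0 : 0 < s := by rw [hs]; positivity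
  have hs1 : a.re + b.re < s := by linarith [le_abs_self (a.re + b.re)]
  have hp0 : ∀ n, 0 < ‖poch (s : ℂ) n‖ := fun n =>
    norm_pos_iff.2 (poch_ne_zero (ofReal_ne_neg_natCast hs0) n)
  have hre : Tendsto (fun N : ℕ => (c + N : ℂ).re) atTop atTop := by
    simpa using tendsto_atTop_add_const_left atTop c.re (tendsto_natCast_atTop_atTop (R := ℝ))
  have hlim : ∀ n, Tendsto (fun N : ℕ => gaussCoeff a b (c + N) n) atTop
      (𝓝 (if n = 0 then 1 else 0)) := by
    intro n
    rcases n with _ | n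
    · simp [gaussCoeff_zero]
    · rw [if_neg (by simp)]
      have h1 : Tendsto (fun N : ℕ => ‖poch a (n + 1) * poch b (n + 1)‖ / ‖poch (s : ℂ) n‖ *
          ((c + N : ℂ).re)⁻¹) atTop (𝓝 0) := by
        simpa using hre.inv_tendsto_atTop.const_mul (‖poch a (n + 1) * poch b (n + 1)‖ / ‖poch (s : ℂ) n‖)
      refine squeeze_zero_norm' ?_ h1
      filter_upwards [hre.eventually_ge_atTop s] with N hN
      have hN0 : 0 < (c + N : ℂ).re := hs0.trans_le hN
      have hp := hp0 n
      rw [gaussCoeff, norm_div, norm_mul (poch (c + N) _), poch_succ_left (c + N), norm_mul (c + N),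
        div_eq_mul_inv, div_eq_mul_inv, mul_assoc _ _ ((c + N : ℂ).re)⁻¹, ← mul_inv,
        Complex.norm_natCast]
      refine mul_le_mul_of_nonneg_left (inv_anti₀ (by positivity) ?_) (norm_nonneg _)
      calc ‖poch (s : ℂ) n‖ * (c + N : ℂ).re ≤ ‖poch (c + N + 1) n‖ * ‖c + N‖ := by
            gcongr
            · exact norm_poch_ge hs0.le (by simp at hN ⊢; linarith) n
            · exact Complex.re_le_norm _
        _ = ‖c + N‖ * ‖poch (c + N + 1) n‖ * (1 : ℝ) := by ring
        _ ≤ _ := by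
            gcongr
            exact_mod_cast Nat.factorial_pos _
  have h := tendsto_tsum_of_dominated_convergence (summable_norm_gaussCoeff_one a b s (by simpa using hs1))
    hlim (by
      filter_upwards [hre.eventually_ge_atTop s] with N hN n
      have hp := hp0 n
      rw [gaussCoeff, gaussCoeff, norm_div, norm_div, norm_mul (poch (c + N) _), norm_mul (poch (s : ℂ) _)]
      have : 0 < ‖((n ! : ℕ) : ℂ)‖ := by simp [Nat.factorial_pos]
      gcongr
      exact norm_poch_ge hs0.le hN n)
  simpa using h

/-- Gauss's summation theorem. -/
lemma tsum_gaussCoeff (a b : ℂ) {c : ℂ} (hc : ∀ n : ℕ, c ≠ -(n : ℂ)) (h : a.re + b.re < c.re) :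
    ∑' n, gaussCoeff a b c n = Complex.Gamma c * Complex.Gamma (c - a - b) *
      ((Complex.Gamma (c - a))⁻¹ * (Complex.Gamma (c - b))⁻¹) := by
  have hc2 : ∀ n : ℕ, c - a - b ≠ -(n : ℂ) := by
    intro n hn
    have := congrArg Complex.re hn
    simp at this
    linarith [(Nat.cast_nonneg n : (0 : ℝ) ≤ n)]
  have hG1 := Complex.Gamma_ne_zero hc
  have hG2 := Complex.Gamma_ne_zero hc2
  -- The relation between lower parameters c and c + n + 1 is rewritten with `GammaSeq` and n → ∞.
  -- The powers of n cancel since c + (c-a-b) = (c-a) + (c-b). Limits of reciprocals allow c - a and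
  -- c - b to be poles of Γ.
  have h1 := ((tendsto_GammaSeq_inv c).mul (tendsto_GammaSeq_inv (c - a - b))).mul_const
    (∑' n, gaussCoeff a b c n)
  have h2 := ((tendsto_GammaSeq_inv (c - a)).mul (tendsto_GammaSeq_inv (c - b))).mul
    ((tendsto_tsum_gaussCoeff a b c).comp (tendsto_add_atTop_nat 1))
  have h3 := tendsto_nhds_unique_of_eventuallyEq h1 h2 (by
    filter_upwards [eventually_ge_atTop 1] with n hn
    have hn0 : n ≠ 0 := by omega
    have key := poch_mul_tsum_gaussCoeff a b hc h (n + 1)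
    have hne : ∀ s : ℂ, (n : ℂ) ^ s ≠ 0 := fun s => by
      rw [Ne, Complex.cpow_eq_zero_iff]
      simp [hn0]
    have hf : (n ! : ℂ) ≠ 0 := by exact_mod_cast n.factorial_ne_zero
    have hpow : (n : ℂ) ^ c * (n : ℂ) ^ (c - a - b) = (n : ℂ) ^ (c - a) * (n : ℂ) ^ (c - b) := by
      rw [← Complex.cpow_add _ _ (by exact_mod_cast hn0), ← Complex.cpow_add _ _ (by exact_mod_cast hn0)]
      congr 1
      ring
    rw [poch_succ_eq_GammaSeq c hn0, poch_succ_eq_GammaSeq (c - a - b) hn0,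
      poch_succ_eq_GammaSeq (c - a) hn0, poch_succ_eq_GammaSeq (c - b) hn0] at key
    simp only [Function.comp_apply]
    refine mul_left_cancel₀ (mul_ne_zero (mul_ne_zero (hne (c - a)) (hne (c - b)))
      (mul_ne_zero hf hf)) ?_
    rw [← mul_assoc, ← mul_assoc _ _ (∑' _, _)]
    nth_rewrite 1 [← hpow]
    linear_combination key)
  rw [mul_one] at h3
  rw [← h3]
  field_simp

/-! ### Beta integrals and the moments of the kernel. -/

lemma integrable_and_hasSum_integral {α : Type*} [MeasurableSpace α] {ν : Measure α}
    {F : ℕ → α → ℂ} {g : α → ℂ} (hF : ∀ n, Integrable (F n) ν)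
    (hsum : Summable fun n => ∫ y, ‖F n y‖ ∂ν) (hlim : ∀ᵐ y ∂ν, HasSum (fun n => F n y) (g y)) :
    Integrable g ν ∧ HasSum (fun n => ∫ y, F n y ∂ν) (∫ y, g y ∂ν) := by
  have hg : g =ᵐ[ν] fun y => ∑' n, F n y := by
    filter_upwards [hlim] with y hy using hy.tsum_eq.symm
  refine ⟨⟨?_, ?_⟩, ?_⟩
  · refine aestronglyMeasurable_of_tendsto_ae atTop
      (f := fun N y => ∑ n ∈ range N, F n y) (fun N => ?_) ?_
    · exact Finset.aestronglyMeasurable_fun_sum _ fun n _ => (hF n).1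
    · filter_upwards [hlim] with y hy using hy.tendsto_sum_nat
  · have h1 : ∫⁻ y, ‖g y‖ₑ ∂ν ≤ ∫⁻ y, ∑' n, ‖F n y‖ₑ ∂ν := by
      refine lintegral_mono_ae ?_
      filter_upwards [hg] with y hy
      rw [hy]
      exact enorm_tsum_le_tsum_enorm
    refine h1.trans_lt ?_
    rw [lintegral_tsum fun n => (hF n).1.enorm, lt_top_iff_ne_top]
    have h2 : ∀ n, ∫⁻ y, ‖F n y‖ₑ ∂ν = ENNReal.ofReal (∫ y, ‖F n y‖ ∂ν) := fun n =>
      (ofReal_integral_norm_eq_lintegral_enorm (hF n)).symm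
    simp only [h2]
    exact hsum.tsum_ofReal_ne_top
  · rw [integral_congr_ae hg]
    exact hasSum_integral_of_summable_integral_norm hF hsum

/-- In terms of the entire function 1/Γ the recurrence holds at poles as well. This covers σ = 1 - μ
when μ is a positive integer. -/
lemma Gamma_inv_eq_poch_mul (z : ℂ) (n : ℕ) :
    (Complex.Gamma z)⁻¹ = poch z n * (Complex.Gamma (z + n))⁻¹ := by
  induction n with
  | zero => simp
  | succ n ih =>
    rw [ih, Complex.one_div_Gamma_eq_self_mul_one_div_Gamma_add_one, poch_succ]
    push_cast
    ring_nf

lemma re_pos_ne_neg_natCast {z : ℂ} (hz : 0 < z.re) (n : ℕ) : z ≠ -(n : ℂ) := by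
  intro h
  have := congrArg Complex.re h
  simp at this
  linarith [(Nat.cast_nonneg n : (0 : ℝ) ≤ n)]

lemma Gamma_add_natCast {z : ℂ} (hz : ∀ n : ℕ, z ≠ -(n : ℂ)) (n : ℕ) :
    Complex.Gamma (z + n) = poch z n * Complex.Gamma z := by
  rw [poch, ← Complex.Gamma_add_nat_div_Gamma_eq z hz, div_mul_cancel₀ _ (Complex.Gamma_ne_zero hz)]

lemma integrableOn_beta {p q : ℂ} (hp : 0 < p.re) (hq : 0 < q.re) :
    IntegrableOn (fun y : ℝ => absPow y (p - 1) * absPow (1 - y) (q - 1)) (Ioo 0 1) ∧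
    ∫ y in Ioo (0 : ℝ) 1, absPow y (p - 1) * absPow (1 - y) (q - 1) =
      Complex.Gamma p * Complex.Gamma q / Complex.Gamma (p + q) := by
  have hcongr : EqOn (fun y : ℝ => (y : ℂ) ^ (p - 1) * (1 - (y : ℂ)) ^ (q - 1))
      (fun y : ℝ => absPow y (p - 1) * absPow (1 - y) (q - 1)) (Ioo 0 1) := by
    intro y hy
    simp only [absPow, abs_of_pos hy.1, abs_of_pos (sub_pos.2 hy.2)]
    push_cast
    rfl
  have hint := (intervalIntegrable_iff_integrableOn_Ioo_of_le zero_le_one).1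
    (Complex.betaIntegral_convergent hp hq)
  refine ⟨hint.congr_fun hcongr measurableSet_Ioo, ?_⟩
  rw [← setIntegral_congr_fun measurableSet_Ioo hcongr, ← Complex.betaIntegral_eq_Gamma_mul_div p q hp hq,
    Complex.betaIntegral, intervalIntegral.integral_of_le zero_le_one, integral_Ioc_eq_integral_Ioo]

lemma integral_norm_beta {p q : ℂ} (hp : 0 < p.re) (hq : 0 < q.re) :
    ∫ y in Ioo (0 : ℝ) 1, ‖absPow y (p - 1) * absPow (1 - y) (q - 1)‖ =
      ‖Complex.Gamma p.re * Complex.Gamma q.re / Complex.Gamma (p.re + q.re)‖ := by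
  rw [← (integrableOn_beta (p := p.re) (q := q.re) (by simpa) (by simpa)).2]
  have h : ∫ y in Ioo (0 : ℝ) 1, absPow y ((p.re : ℂ) - 1) * absPow (1 - y) ((q.re : ℂ) - 1) =
      ((∫ y in Ioo (0 : ℝ) 1, ‖absPow y (p - 1) * absPow (1 - y) (q - 1)‖ : ℝ) : ℂ) := by
    rw [← integral_complex_ofReal]
    refine setIntegral_congr_fun measurableSet_Ioo fun y hy => ?_
    have h1 : 1 - y ≠ 0 := (sub_pos.2 hy.2).ne'
    simp only [norm_mul, norm_absPow hy.1.ne', norm_absPow h1]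
    simp only [Complex.ofReal_mul, Complex.ofReal_cpow (abs_nonneg _), absPow, Complex.sub_re,
      Complex.one_re, Complex.ofReal_sub, Complex.ofReal_one]
  rw [h, Complex.norm_real, Real.norm_of_nonneg]
  positivity

/-- The base integrand `y ^ (δ - 1) (1 - y) ^ (γ - 1) F(α, β; γ; 1 - y)` on `(0, 1)`. -/
noncomputable def betaGaussKernel (α β γ δ : ℂ) (y : ℝ) : ℂ :=
  absPow y (δ - 1) * absPow (1 - y) (γ - 1) * gaussF α β γ (1 - y)

/-- The coefficient is O(n^(Re(α+β-γ)-1)), and the beta integral of absolute values contributes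
n^(-Re δ); the hypothesis makes the product summable. -/
lemma summable_integral_norm_gaussCoeff_mul_beta (α β : ℂ) {γ δ : ℂ} (hγ : 0 < γ.re) (hδ : 0 < δ.re)
    (h : α.re + β.re < γ.re + δ.re) :
    Summable fun n : ℕ => ∫ y in Ioo (0 : ℝ) 1,
      ‖gaussCoeff α β γ n * (absPow y (δ - 1) * absPow (1 - y) (γ + n - 1))‖ := by
  have hγn : ∀ n : ℕ, 0 < (γ + n).re := fun n => by
    simp only [Complex.add_re, Complex.natCast_re]; positivity
  obtain ⟨K, hK0, hK⟩ := exists_norm_poch_le (γ.re : ℂ)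
  obtain ⟨L, hL0, hL⟩ := exists_norm_poch_inv_le ((δ.re : ℂ) + γ.re)
  have hsre : 0 < ((δ.re : ℂ) + γ.re).re := by simp; positivity
  set G : ℂ := Complex.Gamma δ.re * Complex.Gamma γ.re / Complex.Gamma (δ.re + γ.re)
  have hval : ∀ n : ℕ, ∫ y in Ioo (0 : ℝ) 1,
      ‖gaussCoeff α β γ n * (absPow y (δ - 1) * absPow (1 - y) (γ + n - 1))‖ =
      ‖gaussCoeff α β γ n‖ * (‖G‖ * (‖poch (γ.re : ℂ) n‖ * ‖(poch ((δ.re : ℂ) + γ.re) n)⁻¹‖)) := by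
    intro n
    simp only [norm_mul (gaussCoeff α β γ n)]
    rw [integral_const_mul, integral_norm_beta hδ (hγn n)]
    congr 1
    rw [← norm_mul, ← norm_mul]
    congr 1
    have e : (((γ + n).re : ℝ) : ℂ) = (γ.re : ℂ) + n := by simp
    rw [e, ← add_assoc, Gamma_add_natCast (ofReal_ne_neg_natCast hγ),
      Gamma_add_natCast (re_pos_ne_neg_natCast hsre)]
    simp only [G, div_eq_mul_inv, mul_inv]
    ring
  simp only [hval]
  rw [← summable_nat_add_iff 2]
  refine Summable.of_nonneg_of_le (fun n => by positivity) (fun n => ?_)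
    ((summable_norm_gaussCoeff_mul_rpow α β γ (p := -δ.re) (by linarith)).mul_right (‖G‖ * (K * L)))
  have h0 : (0 : ℝ) < ((n + 1 : ℕ) : ℝ) := by positivity
  have hf : (0 : ℝ) < (n + 1)! := by positivity
  calc _ ≤ ‖gaussCoeff α β γ (n + 2)‖ * (‖G‖ * ((K * (((n + 1 : ℕ) : ℝ) ^ γ.re * (n + 1)!)) *
        (L * (((n + 1 : ℕ) : ℝ) ^ (-(δ.re + γ.re)) * ((n + 1)! : ℝ)⁻¹)))) := by
        gcongr
        · simpa using hK (n + 1) (by simp)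
        · simpa using hL (n + 1) (by simp)
    _ = _ := by
        rw [show -(δ.re + γ.re) = -δ.re + -γ.re by ring, Real.rpow_add h0,
          Real.rpow_neg h0.le γ.re]
        field_simp

/-- Termwise beta integrals turn the lower parameter γ into δ + γ, leaving a Gauss series at 1.
Replacing δ by δ + n gives the moments. -/
lemma integral_betaGaussKernel (α β : ℂ) {γ δ : ℂ} (hγ : 0 < γ.re) (hδ : 0 < δ.re)
    (h : 0 < (δ + γ - α - β).re) :
    IntegrableOn (betaGaussKernel α β γ δ) (Ioo 0 1) ∧
    ∫ y in Ioo (0 : ℝ) 1, betaGaussKernel α β γ δ y =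
      Complex.Gamma γ * Complex.Gamma δ * Complex.Gamma (δ + γ - α - β) *
        ((Complex.Gamma (δ + γ - α))⁻¹ * (Complex.Gamma (δ + γ - β))⁻¹) := by
  have hγn : ∀ n : ℕ, 0 < (γ + n).re := fun n => by
    simp only [Complex.add_re, Complex.natCast_re]; positivity
  have hre : 0 < (δ + γ).re := by simp; positivity
  have h' : α.re + β.re < (δ + γ).re := by simp at h ⊢; linarith
  have key := integrable_and_hasSum_integral (ν := volume.restrict (Ioo (0 : ℝ) 1))
    (F := fun (n : ℕ) y => gaussCoeff α β γ n * (absPow y (δ - 1) * absPow (1 - y) (γ + n - 1)))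
    (g := betaGaussKernel α β γ δ)
    (fun n => (integrableOn_beta hδ (hγn n)).1.const_mul _)
    (summable_integral_norm_gaussCoeff_mul_beta α β hγ hδ (by simp at h'; linarith))
    (by
      filter_upwards [ae_restrict_mem measurableSet_Ioo] with y hy
      have h1 : 1 - y ≠ 0 := (sub_pos.2 hy.2).ne'
      have hs := (hasSum_gaussF α β (re_pos_ne_neg_natCast hγ) (x := 1 - y)
        (abs_lt.2 ⟨by linarith [hy.2], by linarith [hy.1]⟩)).mul_left
        (absPow y (δ - 1) * absPow (1 - y) (γ - 1))
      refine hs.congr_fun fun n => ?_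
      rw [show γ + n - 1 = (γ - 1) + n by ring, absPow_add h1]
      have : absPow (1 - y) n = ((1 - y : ℝ) : ℂ) ^ n := by
        rw [absPow, abs_of_pos (sub_pos.2 hy.2), Complex.cpow_natCast]
      rw [this]
      ring)
  refine ⟨key.1, ?_⟩
  have hterm : ∀ n : ℕ, ∫ y in Ioo (0 : ℝ) 1,
      gaussCoeff α β γ n * (absPow y (δ - 1) * absPow (1 - y) (γ + n - 1)) =
      Complex.Gamma γ * Complex.Gamma δ * (Complex.Gamma (δ + γ))⁻¹ * gaussCoeff α β (δ + γ) n := by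
    intro n
    rw [integral_const_mul, (integrableOn_beta hδ (hγn n)).2, ← add_assoc,
      Gamma_add_natCast (re_pos_ne_neg_natCast hγ), Gamma_add_natCast (re_pos_ne_neg_natCast hre),
      gaussCoeff, gaussCoeff]
    have h1 := poch_ne_zero (re_pos_ne_neg_natCast hγ) n
    field_simp
  have h2 := key.2
  simp only [hterm] at h2
  rw [← h2.tsum_eq, tsum_mul_left, tsum_gaussCoeff α β (re_pos_ne_neg_natCast hre) h']
  have := Complex.Gamma_ne_zero_of_re_pos hre
  field_simp

/-! ### The core integral, for |w| < 1 and then for all w < 1. -/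

lemma one_sub_mul_pos {w y : ℝ} (hw : w < 1) (hy : y ∈ Icc (0 : ℝ) 1) : 0 < 1 - w * y := by
  rcases le_or_gt w 0 with h | h
  · nlinarith [hy.1]
  · nlinarith [hy.2]

/-- The n-th moment contains 1/Γ(σ+n) with σ = δ+γ-α. The exponent -σ is chosen so that the binomial
coefficient's (σ)_n absorbs it; otherwise a ₃F₂ would appear. -/
lemma integral_betaGaussKernel_mul_of_abs_lt (α β : ℂ) {γ δ : ℂ} (hγ : 0 < γ.re) (hδ : 0 < δ.re)
    (h : 0 < (δ + γ - α - β).re) (hD : ∀ n : ℕ, δ + γ - β ≠ -(n : ℂ)) {w : ℝ} (hw : |w| < 1) :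
    ∫ y in Ioo (0 : ℝ) 1, betaGaussKernel α β γ δ y * absPow (1 - w * y) (-(δ + γ - α)) =
      Complex.Gamma γ * Complex.Gamma δ * Complex.Gamma (δ + γ - α - β) *
        ((Complex.Gamma (δ + γ - α))⁻¹ * (Complex.Gamma (δ + γ - β))⁻¹) *
        gaussF δ (δ + γ - α - β) (δ + γ - β) w := by
  set σ := δ + γ - α with hσ
  have hδn : ∀ n : ℕ, 0 < (δ + n).re := fun n => by
    simp only [Complex.add_re, Complex.natCast_re]; positivity
  have hn : ∀ n : ℕ, 0 < ((δ + n) + γ - α - β).re := fun n => by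
    have : δ + n + γ - α - β = (δ + γ - α - β) + n := by ring
    rw [this, Complex.add_re, Complex.natCast_re]
    positivity
  have hpow : ∀ n : ℕ, ∀ y ∈ Ioo (0 : ℝ) 1, betaGaussKernel α β γ (δ + n) y =
      betaGaussKernel α β γ δ y * (y : ℂ) ^ n := by
    intro n y hy
    have : absPow y n = (y : ℂ) ^ n := by rw [absPow, abs_of_pos hy.1, Complex.cpow_natCast]
    rw [betaGaussKernel, betaGaussKernel, show δ + n - 1 = (δ - 1) + n by ring,
      absPow_add hy.1.ne', this]
    ring
  have hJ := integral_betaGaussKernel α β hγ hδ h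
  have hJn := fun n : ℕ => integral_betaGaussKernel α β hγ (hδn n) (hn n)
  have key := integrable_and_hasSum_integral (ν := volume.restrict (Ioo (0 : ℝ) 1))
    (F := fun (n : ℕ) y => poch σ n / n ! * (w : ℂ) ^ n * betaGaussKernel α β γ (δ + n) y)
    (g := fun y => betaGaussKernel α β γ δ y * absPow (1 - w * y) (-σ))
    (fun n => (hJn n).1.const_mul _)
    (by
      refine Summable.of_nonneg_of_le (fun n => by positivity) (fun n => ?_)
        (((hasSum_norm_binomial (norm_nonneg σ) (abs_nonneg w) hw).summable).mul_right
          (∫ y in Ioo (0 : ℝ) 1, ‖betaGaussKernel α β γ δ y‖))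
      simp only [norm_mul (_ / _ * _)]
      rw [integral_const_mul]
      gcongr ?_ * ?_
      · rw [norm_mul, norm_div, norm_pow, Complex.norm_natCast, Complex.norm_real, Real.norm_eq_abs]
        gcongr
        simpa using norm_poch_le σ 0 n
      · refine setIntegral_mono_on (hJn n).1.norm hJ.1.norm measurableSet_Ioo fun y hy => ?_
        rw [hpow n y hy, norm_mul, norm_pow, Complex.norm_real, Real.norm_of_nonneg hy.1.le]
        exact mul_le_of_le_one_right (norm_nonneg _) (pow_le_one₀ hy.1.le hy.2.le))
    (by
      filter_upwards [ae_restrict_mem measurableSet_Ioo] with y hy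
      have hwy : ‖((w * y : ℝ) : ℂ)‖ < 1 := by
        rw [Complex.norm_real, norm_mul, Real.norm_eq_abs, Real.norm_of_nonneg hy.1.le]
        nlinarith [hy.1, hy.2, abs_nonneg w]
      have hs := (hasSum_binomial σ hwy).mul_left (betaGaussKernel α β γ δ y)
      have e : absPow (1 - w * y) (-σ) = (1 - ((w * y : ℝ) : ℂ)) ^ (-σ) := by
        rw [absPow, abs_of_pos (one_sub_mul_pos (lt_of_abs_lt hw) ⟨hy.1.le, hy.2.le⟩)]
        push_cast
        rfl
      rw [e]
      refine hs.congr_fun fun n => ?_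
      rw [hpow n y hy]
      push_cast
      ring)
  have hterm : ∀ n : ℕ, ∫ y in Ioo (0 : ℝ) 1,
      poch σ n / n ! * (w : ℂ) ^ n * betaGaussKernel α β γ (δ + n) y =
      Complex.Gamma γ * Complex.Gamma δ * Complex.Gamma (σ - β) *
        ((Complex.Gamma σ)⁻¹ * (Complex.Gamma (δ + γ - β))⁻¹) *
        (gaussCoeff δ (σ - β) (δ + γ - β) n * (w : ℂ) ^ n) := by
    intro n
    rw [integral_const_mul, (hJn n).2, show δ + n + γ - α - β = (σ - β) + n by rw [hσ]; ring,
      show δ + n + γ - α = σ + n by rw [hσ]; ring, show δ + n + γ - β = (δ + γ - β) + n by ring,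
      Gamma_add_natCast (re_pos_ne_neg_natCast hδ), Gamma_add_natCast (re_pos_ne_neg_natCast h),
      Gamma_inv_eq_poch_mul σ n, Gamma_inv_eq_poch_mul (δ + γ - β) n, gaussCoeff]
    have := poch_ne_zero hD n
    field_simp
  have h2 := key.2
  simp only [hterm] at h2
  exact h2.unique ((hasSum_gaussF δ (σ - β) hD hw).mul_left _)

/-- For Re z < 1 and y in [0,1] the number 1 - zy has positive real part, so the power is continuous
on a compact set. The case m = 0 serves integrability, m = 1 the derivative in z. -/
lemma exists_bound_mul_cpow (s : ℂ) (m : ℕ) {w : ℂ} {r : ℝ} (hr : ∀ z ∈ Metric.closedBall w r, z.re < 1) :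
    ∃ C : ℝ, ∀ z ∈ Metric.closedBall w r, ∀ y ∈ Icc (0 : ℝ) 1,
      ‖(y : ℂ) ^ m * (1 - z * (y : ℂ)) ^ s‖ ≤ C := by
  have hc : ContinuousOn (fun p : ℂ × ℝ => (p.2 : ℂ) ^ m * (1 - p.1 * (p.2 : ℂ)) ^ s)
      (Metric.closedBall w r ×ˢ Icc (0 : ℝ) 1) := by
    refine ContinuousOn.mul (by fun_prop) (ContinuousOn.cpow (by fun_prop) continuousOn_const ?_)
    rintro ⟨z, y⟩ ⟨hz, hy⟩
    left
    simpa using one_sub_mul_pos (hr z hz) hy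
  obtain ⟨C, hC⟩ := ((isCompact_closedBall w r).prod isCompact_Icc).exists_bound_of_continuousOn hc
  exact ⟨C, fun z hz y hy => hC (z, y) ⟨hz, hy⟩⟩

lemma continuousOn_one_sub_mul_cpow (s : ℂ) {z : ℂ} (hz : z.re < 1) :
    ContinuousOn (fun y : ℝ => (1 - z * (y : ℂ)) ^ s) (Ioo 0 1) := by
  refine ContinuousOn.cpow (by fun_prop) continuousOn_const fun y hy => ?_
  left
  simpa using one_sub_mul_pos hz ⟨hy.1.le, hy.2.le⟩

lemma integrableOn_mul_one_sub_mul_cpow {g : ℝ → ℂ} (hg : IntegrableOn g (Ioo 0 1)) (s : ℂ) {z : ℂ}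
    (hz : z.re < 1) : IntegrableOn (fun y : ℝ => g y * (1 - z * (y : ℂ)) ^ s) (Ioo 0 1) := by
  obtain ⟨C, hC⟩ := exists_bound_mul_cpow s 0 (w := z) (r := 0) (by simpa using hz)
  refine Integrable.mul_bdd (c := C) hg
    ((continuousOn_one_sub_mul_cpow s hz).aestronglyMeasurable measurableSet_Ioo) ?_
  filter_upwards [ae_restrict_mem measurableSet_Ioo] with y hy
  simpa using hC z (by simp) y ⟨hy.1.le, hy.2.le⟩

lemma differentiableAt_integral_mul_cpow {g : ℝ → ℂ} (hg : IntegrableOn g (Ioo 0 1)) (s : ℂ) {w : ℂ}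
    (hw : w.re < 1) :
    DifferentiableAt ℂ (fun z : ℂ => ∫ y in Ioo (0 : ℝ) 1, g y * (1 - z * (y : ℂ)) ^ s) w := by
  obtain ⟨r, hr0, hr⟩ := Metric.nhds_basis_closedBall.mem_iff.1
    ((isOpen_lt Complex.continuous_re continuous_const).mem_nhds hw)
  obtain ⟨C, hC⟩ := exists_bound_mul_cpow (s - 1) 1 (fun z hz => hr hz)
  refine (hasDerivAt_integral_of_dominated_loc_of_deriv_le (Metric.closedBall_mem_nhds w hr0)
    (F := fun z y => g y * (1 - z * (y : ℂ)) ^ s)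
    (F' := fun z y => g y * (s * (1 - z * (y : ℂ)) ^ (s - 1) * (-(y : ℂ))))
    (bound := fun y => ‖g y‖ * (‖s‖ * C)) ?_ (integrableOn_mul_one_sub_mul_cpow hg s hw) ?_ ?_
    (hg.norm.mul_const _) ?_).2.differentiableAt
  · filter_upwards [(isOpen_lt Complex.continuous_re continuous_const).mem_nhds hw] with z hz
    exact (integrableOn_mul_one_sub_mul_cpow hg s hz).1
  · refine hg.1.mul (ContinuousOn.aestronglyMeasurable ?_ measurableSet_Ioo)
    exact (continuousOn_const.mul (continuousOn_one_sub_mul_cpow (s - 1) hw)).mul (by fun_prop)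
  · filter_upwards [ae_restrict_mem measurableSet_Ioo] with y hy z hz
    have := hC z hz y ⟨hy.1.le, hy.2.le⟩
    rw [pow_one, norm_mul] at this
    rw [norm_mul, norm_mul, norm_mul, norm_neg, mul_assoc ‖s‖, mul_comm ‖_ ^ _‖]
    gcongr
  · filter_upwards [ae_restrict_mem measurableSet_Ioo] with y hy z hz
    refine HasDerivAt.const_mul _ ?_
    have h1 : HasDerivAt (fun z : ℂ => 1 - z * (y : ℂ)) (-(y : ℂ)) z := by
      simpa using ((hasDerivAt_id z).mul_const (y : ℂ)).const_sub 1
    refine h1.cpow_const ?_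
    left
    simpa using one_sub_mul_pos (hr hz) ⟨hy.1.le, hy.2.le⟩

/-- The generalized Stieltjes transform of the base kernel. -/
lemma integral_betaGaussKernel_mul (α β : ℂ) {γ δ : ℂ} (hγ : 0 < γ.re) (hδ : 0 < δ.re)
    (h : 0 < (δ + γ - α - β).re) (hD : ∀ n : ℕ, δ + γ - β ≠ -(n : ℂ)) {w : ℝ} (hw : w < 1) :
    IntegrableOn (fun y => betaGaussKernel α β γ δ y * absPow (1 - w * y) (-(δ + γ - α)))
      (Ioo 0 1) ∧
    ∫ y in Ioo (0 : ℝ) 1, betaGaussKernel α β γ δ y * absPow (1 - w * y) (-(δ + γ - α)) =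
      Complex.Gamma γ * Complex.Gamma δ * Complex.Gamma (δ + γ - α - β) *
        ((Complex.Gamma (δ + γ - α))⁻¹ * (Complex.Gamma (δ + γ - β))⁻¹) *
        gaussF δ (δ + γ - α - β) (δ + γ - β) w := by
  have hJ := (integral_betaGaussKernel α β hγ hδ h).1
  have hcongr : ∀ w : ℝ, w < 1 → EqOn (fun y : ℝ => betaGaussKernel α β γ δ y *
        (1 - (w : ℂ) * (y : ℂ)) ^ (-(δ + γ - α)))
      (fun y => betaGaussKernel α β γ δ y * absPow (1 - w * y) (-(δ + γ - α))) (Ioo 0 1) := by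
    intro w hw y hy
    simp only [absPow, abs_of_pos (one_sub_mul_pos hw ⟨hy.1.le, hy.2.le⟩)]
    push_cast
    rfl
  refine ⟨(integrableOn_mul_one_sub_mul_cpow hJ _ (by simpa using hw)).congr_fun (hcongr w hw)
    measurableSet_Ioo, ?_⟩
  have hopen : IsOpen {z : ℂ | z.re < 1} := isOpen_lt Complex.continuous_re continuous_const
  have hH : AnalyticOnNhd ℂ (fun z : ℂ => ∫ y in Ioo (0 : ℝ) 1, betaGaussKernel α β γ δ y *
      (1 - z * (y : ℂ)) ^ (-(δ + γ - α))) {z : ℂ | z.re < 1} :=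
    DifferentiableOn.analyticOnNhd
      (fun z hz => (differentiableAt_integral_mul_cpow hJ _ hz).differentiableWithinAt) hopen
  have hL : AnalyticOnNhd ℝ (fun w : ℝ => ∫ y in Ioo (0 : ℝ) 1, betaGaussKernel α β γ δ y *
      (1 - (w : ℂ) * (y : ℂ)) ^ (-(δ + γ - α))) (Iio 1) := fun w hw =>
    analyticAt_ofReal_comp (hH w (by simpa using hw))
  have hR : AnalyticOnNhd ℝ (fun w : ℝ => Complex.Gamma γ * Complex.Gamma δ *
      Complex.Gamma (δ + γ - α - β) *
        ((Complex.Gamma (δ + γ - α))⁻¹ * (Complex.Gamma (δ + γ - β))⁻¹) *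
        gaussF δ (δ + γ - α - β) (δ + γ - β) w) (Iio 1) := fun w hw =>
    analyticAt_const.mul ((isGaussContinuation_gaussF _ _ hD).1 w hw)
  -- The integral is holomorphic on the half-plane Re z < 1, which contains the whole ray (-∞, 1).
  -- Agreement on (-1, 1) therefore propagates along the ray.
  have key := hL.eqOn_of_preconnected_of_eventuallyEq hR isPreconnected_Iio (z₀ := 0) (by simp) (by
    filter_upwards [Ioo_mem_nhds (a := (-1 : ℝ)) (b := 1) (by norm_num) (by norm_num)] with w hw
    rw [setIntegral_congr_fun measurableSet_Ioo (hcongr w hw.2)]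
    exact integral_betaGaussKernel_mul_of_abs_lt α β hγ hδ h hD (abs_lt.2 hw)) hw
  rw [← setIntegral_congr_fun measurableSet_Ioo (hcongr w hw)]
  exact key

end GaussStieltjes

namespace GaussStieltjes

/-! ### Symmetries of the Stieltjes formula. -/

/-- C and D are the lower parameters in the base forms of f and g. Offering their admissibility to
`hf` and `hg` lets Pfaff and Euler be used there. -/
lemma StieltjesFormula.congr {S : Set ℝ} (hS : MeasurableSet S) {μ : ℂ} {f f' g g' : ℝ → ℂ}
    {A B C D : ℂ} (h : StieltjesFormula S μ f g A B C D)
    (hf : (∀ n : ℕ, C ≠ -(n : ℂ)) → ∀ y ∈ S, f' y = f y)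
    (hg : (∀ n : ℕ, D ≠ -(n : ℂ)) → ∀ x ∈ (Iio (0 : ℝ) ∪ Ioo 0 1 ∪ Ioi 1) \ S, g' x = g x) :
    StieltjesFormula S μ f' g' A B C D := by
  intro hA hB hC hD x hx
  obtain ⟨h1, h2⟩ := h hA hB hC hD x hx
  have he : EqOn (fun y => f y * absPow (x - y) (μ - 1)) (fun y => f' y * absPow (x - y) (μ - 1)) S :=
    fun y hy => by simp only [hf (re_pos_ne_neg_natCast hC) y hy]
  rw [hg hD x hx]
  exact ⟨h1.congr_fun he hS, by rw [← setIntegral_congr_fun hS he, h2]⟩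

lemma mem_regular_one_sub {x : ℝ} :
    1 - x ∈ Iio (0 : ℝ) ∪ Ioo 0 1 ∪ Ioi 1 ↔ x ∈ Iio (0 : ℝ) ∪ Ioo 0 1 ∪ Ioi 1 := by
  simp only [mem_union, mem_Iio, mem_Ioo, mem_Ioi]
  constructor
  · rintro ((h | h) | h)
    · exact Or.inr (by linarith)
    · exact Or.inl (Or.inr ⟨by linarith, by linarith⟩)
    · exact Or.inl (Or.inl (by linarith))
  · rintro ((h | h) | h)
    · exact Or.inr (by linarith)
    · exact Or.inl (Or.inr ⟨by linarith, by linarith⟩)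
    · exact Or.inl (Or.inl (by linarith))

lemma StieltjesFormula.reflect {S : Set ℝ} {μ : ℂ} {f g : ℝ → ℂ} {A B C D : ℂ}
    (h : StieltjesFormula S μ f g A B C D) :
    StieltjesFormula ((fun y => 1 - y) ⁻¹' S) μ (fun y => f (1 - y)) (fun x => g (1 - x)) A B C D := by
  intro hA hB hC hD x hx
  obtain ⟨h1, h2⟩ := h hA hB hC hD (1 - x) ⟨mem_regular_one_sub.2 hx.1, hx.2⟩
  have hmp := (volume : Measure ℝ).measurePreserving_sub_left 1
  have hme := (MeasurableEquiv.subLeft (1 : ℝ)).measurableEmbedding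
  have e : (fun y => f (1 - y) * absPow (x - y) (μ - 1)) =
      (fun y => f y * absPow (1 - x - y) (μ - 1)) ∘ fun y => 1 - y := by
    funext y
    simp only [Function.comp_apply, sub_sub_sub_cancel_left]
    rw [absPow_sub_comm y x]
  rw [e]
  refine ⟨(hmp.integrableOn_comp_preimage hme).2 h1, ?_⟩
  rw [← h2]
  exact hmp.setIntegral_preimage_emb hme (fun y => f y * absPow (1 - x - y) (μ - 1)) S

lemma image_inv_Ioo : (fun u : ℝ => u⁻¹) '' Ioo 0 1 = Ioi 1 := by
  ext y
  simp only [mem_image, mem_Ioo, mem_Ioi]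
  constructor
  · rintro ⟨u, ⟨h0, h1⟩, rfl⟩
    exact (one_lt_inv₀ h0).2 h1
  · intro hy
    have : 0 < y := by linarith
    exact ⟨y⁻¹, ⟨by positivity, inv_lt_one_of_one_lt₀ hy⟩, inv_inv y⟩

/-- Under y = 1/u one has |x - y| = |x| |1/x - u| / u and dy becomes u^(-2) du. The weight
|y|^(-μ-1) is the one that cancels all powers of u. -/
lemma StieltjesFormula.invert {μ : ℂ} {f g : ℝ → ℂ} {A B C D : ℂ}
    (h : StieltjesFormula (Ioo 0 1) μ f g A B C D) :
    StieltjesFormula (Ioi 1) μ (fun y => absPow y (-μ - 1) * f y⁻¹)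
      (fun x => absPow x (μ - 1) * g x⁻¹) A B C D := by
  intro hA hB hC hD x hx
  have hx0 : x ≠ 0 := by
    rintro rfl
    simp at hx
  have hx' : x⁻¹ ∈ (Iio (0 : ℝ) ∪ Ioo 0 1 ∪ Ioi 1) \ Ioo 0 1 := by
    simp only [mem_sdiff, mem_union, mem_Iio, mem_Ioo, mem_Ioi] at hx ⊢
    rcases hx with ⟨(h | h) | h, h'⟩
    · exact ⟨Or.inl (Or.inl (inv_lt_zero.2 h)), fun h2 => by linarith [inv_lt_zero.2 h, h2.1]⟩
    · have := (one_lt_inv₀ h.1).2 h.2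
      exact ⟨Or.inr this, fun h2 => by linarith [h2.2]⟩
    · exact absurd h h'
  obtain ⟨h1, h2⟩ := h hA hB hC hD x⁻¹ hx'
  have hder : ∀ u ∈ Ioo (0 : ℝ) 1,
      HasDerivWithinAt (fun u : ℝ => u⁻¹) (-(u ^ 2)⁻¹) (Ioo 0 1) u := fun u hu =>
    (hasDerivAt_inv hu.1.ne').hasDerivWithinAt
  have hinj : InjOn (fun u : ℝ => u⁻¹) (Ioo 0 1) := inv_injective.injOn
  set G : ℝ → ℂ := fun y => absPow y (-μ - 1) * f y⁻¹ * absPow (x - y) (μ - 1)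
  have e : EqOn (fun u => absPow x (μ - 1) * (f u * absPow (x⁻¹ - u) (μ - 1)))
      (fun u => |-(u ^ 2)⁻¹| • G u⁻¹) (Ioo 0 1) := by
    intro u hu
    have hu0 := hu.1.ne'
    have e1 : x - u⁻¹ = -(x * (x⁻¹ - u) * u⁻¹) := by field_simp; ring
    have e2 : ((|-(u ^ 2)⁻¹| : ℝ) : ℂ) = absPow u (-2) := by
      rw [absPow, show (-2 : ℂ) = ((-2 : ℤ) : ℂ) by norm_num, Complex.cpow_intCast, abs_neg, abs_inv,
        abs_pow]
      push_cast
      rfl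
    simp only [G, inv_inv]
    rw [e1, absPow_neg_left, absPow_mul, absPow_mul, absPow_inv, absPow_inv, Complex.real_smul, e2]
    have e3 : absPow u (-2) * absPow u (-(-μ - 1)) * absPow u (-(μ - 1)) = 1 := by
      rw [← absPow_add hu0, ← absPow_add hu0]
      refine Eq.trans ?_ (absPow_zero u)
      congr 1
      ring
    linear_combination (-(absPow x (μ - 1) * (f u * absPow (x⁻¹ - u) (μ - 1)))) * e3
  rw [← image_inv_Ioo]
  constructor
  · rw [integrableOn_image_iff_integrableOn_abs_deriv_smul measurableSet_Ioo hder hinj]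
    exact IntegrableOn.congr_fun (h1.const_mul _) e measurableSet_Ioo
  · rw [integral_image_eq_integral_abs_deriv_smul measurableSet_Ioo hder hinj,
      ← setIntegral_congr_fun measurableSet_Ioo e, integral_const_mul, h2]
    ring

/-! ### The six base forms. -/

/-- The base formula on `(0, 1)`, with argument `1 - y`. -/
lemma stieltjesFormula_Ioo_one_sub (μ A B C : ℂ) :
    StieltjesFormula (Ioo 0 1) μ
      (fun y => absPow y (B - 1) * absPow (1 - y) (C - 1) *
        gaussF (B + C + μ - 1) (1 - μ - A) C (1 - y))
      (fun x => absPow x (μ - 1) * gaussF A B (A + B + C + μ - 1) x⁻¹)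
      A B C (A + B + C + μ - 1) := by
  intro hA hB hC hD x hx
  have hx' : x ≠ 0 ∧ x⁻¹ < 1 := by
    simp only [mem_sdiff, mem_union, mem_Iio, mem_Ioo, mem_Ioi] at hx
    rcases hx with ⟨(h | h) | h, h'⟩
    · exact ⟨h.ne, (inv_lt_zero.2 h).trans one_pos⟩
    · exact absurd h h'
    · exact ⟨by linarith, inv_lt_one_of_one_lt₀ h⟩
  obtain ⟨hx0, hx1⟩ := hx'
  have e1 : B + C - (B + C + μ - 1) - (1 - μ - A) = A := by ring
  have e2 : B + C - (1 - μ - A) = A + B + C + μ - 1 := by ring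
  have e3 : B + C - (B + C + μ - 1) = 1 - μ := by ring
  -- The core parameters are γ = C, δ = B, w = 1/x; α and β solve δ+γ-α = 1-μ and δ+γ-α-β = A.
  obtain ⟨h1, h2⟩ := integral_betaGaussKernel_mul (B + C + μ - 1) (1 - μ - A) hC hB
    (by rwa [e1]) (by rwa [e2]) hx1
  rw [e3] at h1
  rw [e1, e2, e3] at h2
  have e : (fun y => absPow y (B - 1) * absPow (1 - y) (C - 1) *
        gaussF (B + C + μ - 1) (1 - μ - A) C (1 - y) * absPow (x - y) (μ - 1)) =
      fun y => absPow x (μ - 1) * (betaGaussKernel (B + C + μ - 1) (1 - μ - A) C B y *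
        absPow (1 - x⁻¹ * y) (-(1 - μ))) := by
    funext y
    rw [show x - y = x * (1 - x⁻¹ * y) by field_simp, absPow_mul, betaGaussKernel, neg_sub]
    ring
  rw [e]
  refine ⟨h1.const_mul _, ?_⟩
  rw [integral_const_mul, h2, gaussF_comm B A, div_eq_mul_inv, mul_inv]
  ring

lemma preimage_one_sub_Ioo : (fun y : ℝ => 1 - y) ⁻¹' Ioo 0 1 = Ioo 0 1 := by simp

lemma preimage_one_sub_Ioi : (fun y : ℝ => 1 - y) ⁻¹' Ioi 1 = Iio 0 := by simp

lemma one_sub_div_sub_one {y : ℝ} (hy : y ≠ 0) : (1 - y) / (1 - y - 1) = 1 - y⁻¹ := by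
  rw [show 1 - y - 1 = -y by ring]
  field_simp
  ring

lemma inv_div_sub_one {y : ℝ} (hy : y ≠ 0) : y⁻¹ / (y⁻¹ - 1) = (1 - y)⁻¹ := by
  rcases eq_or_ne y 1 with rfl | h
  · simp
  · have h1 : 1 - y ≠ 0 := sub_ne_zero.2 h.symm
    have h2 : y⁻¹ - 1 ≠ 0 := by rwa [show y⁻¹ - 1 = (1 - y) / y by field_simp, div_ne_zero_iff, and_iff_left hy]
    field_simp

/-- Pfaff's transformation, from the argument `x / (x - 1)` to the argument `x`. -/
lemma gaussF_div_sub_one (a b : ℂ) {c : ℂ} (hc : ∀ n : ℕ, c ≠ -(n : ℂ)) {x : ℝ} (hx : x < 1) :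
    gaussF a b c (x / (x - 1)) = absPow (1 - x) a * gaussF a (c - b) c x := by
  have hx0 : 1 - x ≠ 0 := by linarith
  rw [gaussF_pfaff a (c - b) hc hx, sub_sub_cancel, ← mul_assoc, ← absPow_add hx0, add_neg_cancel,
    absPow_zero, one_mul]

lemma absPow_one_sub_inv {y : ℝ} (hy : y ≠ 0) (p : ℂ) :
    absPow (1 - y⁻¹) p = absPow (1 - y) p * absPow y (-p) := by
  rw [show 1 - y⁻¹ = -((1 - y) * y⁻¹) by field_simp; ring, absPow_neg_left, absPow_mul, absPow_inv]

lemma ne_of_mem_regular {x : ℝ} (hx : x ∈ Iio (0 : ℝ) ∪ Ioo 0 1 ∪ Ioi 1) : x ≠ 0 ∧ 1 - x ≠ 0 := by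
  rcases hx with (h | h) | h
  · exact ⟨ne_of_lt h, by linarith [mem_Iio.1 h]⟩
  · exact ⟨h.1.ne', by linarith [h.2]⟩
  · exact ⟨by linarith [mem_Ioi.1 h], by linarith [mem_Ioi.1 h]⟩

lemma inv_lt_one_of_notMem_Ioo {x : ℝ} (hx : x ∈ (Iio (0 : ℝ) ∪ Ioo 0 1 ∪ Ioi 1) \ Ioo 0 1) :
    x⁻¹ < 1 := by
  rcases hx with ⟨(h | h) | h, h'⟩
  · exact (inv_lt_zero.2 h).trans one_pos
  · exact absurd h h'
  · exact inv_lt_one_of_one_lt₀ h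

lemma lt_one_of_notMem_Ioi {x : ℝ} (hx : x ∈ (Iio (0 : ℝ) ∪ Ioo 0 1 ∪ Ioi 1) \ Ioi 1) : x < 1 := by
  rcases hx with ⟨(h | h) | h, h'⟩
  · exact h.trans one_pos
  · exact h.2
  · exact absurd h h'

lemma pos_of_notMem_Iio {x : ℝ} (hx : x ∈ (Iio (0 : ℝ) ∪ Ioo 0 1 ∪ Ioi 1) \ Iio 0) : 0 < x := by
  rcases hx with ⟨(h | h) | h, h'⟩
  · exact absurd h h'
  · exact h.1
  · exact one_pos.trans h

/-- The formula on `(0, 1)`, with argument `y`. -/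
lemma stieltjesFormula_Ioo (μ A B C : ℂ) :
    StieltjesFormula (Ioo 0 1) μ
      (fun y => absPow y (C - 1) * absPow (1 - y) (B - 1) *
        gaussF (B + C + μ - 1) (1 - μ - A) C y)
      (fun x => absPow x (-B) * absPow (1 - x) (B + μ - 1) *
        gaussF B (B + C + μ - 1) (A + B + C + μ - 1) x⁻¹)
      A B C (A + B + C + μ - 1) := by
  have h := (stieltjesFormula_Ioo_one_sub μ A B C).reflect
  rw [preimage_one_sub_Ioo] at h
  refine h.congr measurableSet_Ioo (fun _ y _ => ?_) (fun hD x hx => ?_)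
  · rw [sub_sub_cancel]
    ring
  · obtain ⟨hx0, hx1⟩ := ne_of_mem_regular hx.1
    -- Reflection leaves the argument 1/(1-x), which is the Pfaff variable of 1/x; Pfaff's
    -- transformation returns it to 1/x.
    rw [← inv_div_sub_one hx0, gaussF_comm A, gaussF_div_sub_one _ _ hD (inv_lt_one_of_notMem_Ioo hx),
      absPow_one_sub_inv hx0, show B + μ - 1 = (μ - 1) + B by ring, absPow_add hx1,
      show A + B + C + μ - 1 - A = μ - 1 + B + C by ring, show B + C + μ - 1 = μ - 1 + B + C by ring]
    ring

/-- The formula on `(1, ∞)`, with argument `y⁻¹`. -/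
lemma stieltjesFormula_Ioi_inv (μ A B C : ℂ) :
    StieltjesFormula (Ioi 1) μ
      (fun y => absPow y (1 - μ - B - C) * absPow (1 - y) (B - 1) *
        gaussF (B + C + μ - 1) (1 - μ - A) C y⁻¹)
      (fun x => absPow (1 - x) (B + μ - 1) * gaussF B (B + C + μ - 1) (A + B + C + μ - 1) x)
      A B C (A + B + C + μ - 1) := by
  refine (stieltjesFormula_Ioo μ A B C).invert.congr measurableSet_Ioi (fun _ y hy => ?_)
    (fun hD x hx => ?_)
  · have hy0 : y ≠ 0 := by linarith [mem_Ioi.1 hy]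
    rw [absPow_one_sub_inv hy0, absPow_inv,
      show 1 - μ - B - C = (-μ - 1) + -(C - 1) + -(B - 1) by ring, absPow_add hy0, absPow_add hy0]
    ring
  · obtain ⟨hx0, hx1⟩ := ne_of_mem_regular hx.1
    rw [absPow_one_sub_inv hx0, absPow_inv, inv_inv]
    have : absPow x (μ - 1) * absPow x (- -B) * absPow x (-(B + μ - 1)) = 1 := by
      rw [← absPow_add hx0, ← absPow_add hx0]
      refine Eq.trans ?_ (absPow_zero x)
      congr 1
      ring
    linear_combination (-(absPow (1 - x) (B + μ - 1) *
      gaussF B (B + C + μ - 1) (A + B + C + μ - 1) x)) * this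

/-- The formula on `(1, ∞)`, with argument `1 - y`. -/
lemma stieltjesFormula_Ioi_one_sub (μ A B C : ℂ) :
    StieltjesFormula (Ioi 1) μ
      (fun y => absPow (1 - y) (C - 1) * gaussF (A + C + μ - 1) (B + C + μ - 1) C (1 - y))
      (fun x => gaussF A B (A + B + C + μ - 1) x)
      A B C (A + B + C + μ - 1) := by
  refine (stieltjesFormula_Ioo_one_sub μ A B C).invert.congr measurableSet_Ioi (fun hC y hy => ?_)
    (fun hD x hx => ?_)
  · have hy0 : y ≠ 0 := by linarith [mem_Ioi.1 hy]
    rw [← one_sub_div_sub_one hy0, gaussF_div_sub_one _ _ hC (by linarith [mem_Ioi.1 hy]),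
      one_sub_div_sub_one hy0, absPow_one_sub_inv hy0, absPow_inv, sub_sub_cancel,
      gaussF_comm (A + C + μ - 1), show C - (1 - μ - A) = A + C + μ - 1 by ring]
    have : absPow y (-μ - 1) * absPow y (-(B - 1)) * absPow y (-(C - 1)) *
        absPow y (B + C + μ - 1) = 1 := by
      rw [← absPow_add hy0, ← absPow_add hy0, ← absPow_add hy0]
      refine Eq.trans ?_ (absPow_zero y)
      congr 1
      ring
    linear_combination (-(absPow (1 - y) (C - 1) *
      gaussF (B + C + μ - 1) (A + C + μ - 1) C (1 - y))) * this
  · obtain ⟨hx0, hx1⟩ := ne_of_mem_regular hx.1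
    rw [absPow_inv, inv_inv, ← mul_assoc, ← absPow_add hx0, add_neg_cancel, absPow_zero, one_mul]

/-- The formula on `(-∞, 0)`, with argument `y`. -/
lemma stieltjesFormula_Iio (μ A B C : ℂ) :
    StieltjesFormula (Iio 0) μ
      (fun y => absPow y (C - 1) * gaussF (A + C + μ - 1) (B + C + μ - 1) C y)
      (fun x => gaussF A B (A + B + C + μ - 1) (1 - x))
      A B C (A + B + C + μ - 1) := by
  have h := (stieltjesFormula_Ioi_one_sub μ A B C).reflect
  rw [preimage_one_sub_Ioi] at h
  exact h.congr measurableSet_Iio (fun _ y _ => by rw [sub_sub_cancel]) (fun _ _ _ => rfl)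

/-- The formula on `(-∞, 0)`, with argument `y⁻¹`. -/
lemma stieltjesFormula_Iio_inv (μ A B C : ℂ) :
    StieltjesFormula (Iio 0) μ
      (fun y => absPow y (-C - μ) * gaussF (A + C + μ - 1) (B + C + μ - 1) C y⁻¹)
      (fun x => absPow x (B + μ - 1) * gaussF B (B + C + μ - 1) (A + B + C + μ - 1) (1 - x))
      A B C (A + B + C + μ - 1) := by
  have h := (stieltjesFormula_Ioi_inv μ A B C).reflect
  rw [preimage_one_sub_Ioi] at h
  refine h.congr measurableSet_Iio (fun hC y hy => ?_) (fun _ x _ => by rw [sub_sub_cancel])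
  have hy' : y < 0 := hy
  have hy0 : y ≠ 0 := hy'.ne
  have hy1 : 1 - y ≠ 0 := by linarith
  rw [← inv_div_sub_one hy0, gaussF_div_sub_one _ _ hC ((inv_lt_zero.2 hy').trans one_pos),
    absPow_one_sub_inv hy0, sub_sub_cancel, gaussF_comm (A + C + μ - 1),
    show C - (1 - μ - A) = A + C + μ - 1 by ring,
    show -C - μ = (B - 1) + -(B + C + μ - 1) by ring, absPow_add hy0]
  have : absPow (1 - y) (1 - μ - B - C) * absPow (1 - y) (B + C + μ - 1) = 1 := by
    rw [← absPow_add hy1]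
    refine Eq.trans ?_ (absPow_zero (1 - y))
    congr 1
    ring
  linear_combination (-(absPow y (B - 1) * absPow y (-(B + C + μ - 1)) *
    gaussF (B + C + μ - 1) (A + C + μ - 1) C y⁻¹)) * this

/-! ### Matching a given formula with a base form. -/

/-- The product `|y| ^ p |1 - y| ^ q`. -/
noncomputable def absPow₂ (y : ℝ) (p q : ℂ) : ℂ := absPow y p * absPow (1 - y) q

lemma absPow_eq_absPow₂ (y : ℝ) (p : ℂ) : absPow y p = absPow₂ y p 0 := by simp [absPow₂]

lemma absPow_one_sub_eq_absPow₂ (y : ℝ) (q : ℂ) : absPow (1 - y) q = absPow₂ y 0 q := by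
  simp [absPow₂]

lemma absPow₂_mul {y : ℝ} (h0 : y ≠ 0) (h1 : 1 - y ≠ 0) (p q p' q' : ℂ) :
    absPow₂ y p q * absPow₂ y p' q' = absPow₂ y (p + p') (q + q') := by
  simp only [absPow₂, absPow_add h0, absPow_add h1]
  ring

/-- The trivial factor gives every side at least one `absPow₂` to collect powers in, even when it
shows none. Each side then becomes one `absPow₂` times one `gaussF`, and only linear identities
among parameters remain. -/
lemma eq_of_absPow₂_mul (y : ℝ) {u v : ℂ} (h : absPow₂ y 0 0 * u = absPow₂ y 0 0 * v) : u = v := by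
  simpa [absPow₂] using h

variable {μ A B C D : ℂ} {f g : ℝ → ℂ}

/-- This and its five analogues leave D free up to an equation, and turn interval membership into
the facts that rewriting needs: nonzero bases, and a hypergeometric argument below 1. -/
lemma stieltjesFormula_of_Ioo_one_sub (hD : D = A + B + C + μ - 1)
    (hf : ∀ y : ℝ, y ≠ 0 → 1 - y ≠ 0 → 1 - y < 1 → (∀ n : ℕ, C ≠ -(n : ℂ)) →
      f y = absPow y (B - 1) * absPow (1 - y) (C - 1) *
      gaussF (B + C + μ - 1) (1 - μ - A) C (1 - y))
    (hg : ∀ x : ℝ, x ≠ 0 → 1 - x ≠ 0 → x⁻¹ < 1 → (∀ n : ℕ, A + B + C + μ - 1 ≠ -(n : ℂ)) →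
      g x = absPow x (μ - 1) * gaussF A B (A + B + C + μ - 1) x⁻¹) :
    StieltjesFormula (Ioo 0 1) μ f g A B C D := by
  subst hD
  exact (stieltjesFormula_Ioo_one_sub μ A B C).congr measurableSet_Ioo
    (fun hC y hy => hf y (ne_of_mem_regular (Or.inl (Or.inr hy))).1
      (ne_of_mem_regular (Or.inl (Or.inr hy))).2 (by linarith [hy.1]) hC)
    (fun hD x hx => hg x (ne_of_mem_regular hx.1).1 (ne_of_mem_regular hx.1).2
      (inv_lt_one_of_notMem_Ioo hx) hD)

lemma stieltjesFormula_of_Ioo (hD : D = A + B + C + μ - 1)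
    (hf : ∀ y : ℝ, y ≠ 0 → 1 - y ≠ 0 → y < 1 → (∀ n : ℕ, C ≠ -(n : ℂ)) →
      f y = absPow y (C - 1) * absPow (1 - y) (B - 1) *
      gaussF (B + C + μ - 1) (1 - μ - A) C y)
    (hg : ∀ x : ℝ, x ≠ 0 → 1 - x ≠ 0 → x⁻¹ < 1 → (∀ n : ℕ, A + B + C + μ - 1 ≠ -(n : ℂ)) →
      g x = absPow x (-B) * absPow (1 - x) (B + μ - 1) *
      gaussF B (B + C + μ - 1) (A + B + C + μ - 1) x⁻¹) :
    StieltjesFormula (Ioo 0 1) μ f g A B C D := by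
  subst hD
  exact (stieltjesFormula_Ioo μ A B C).congr measurableSet_Ioo
    (fun hC y hy => hf y (ne_of_mem_regular (Or.inl (Or.inr hy))).1
      (ne_of_mem_regular (Or.inl (Or.inr hy))).2 hy.2 hC)
    (fun hD x hx => hg x (ne_of_mem_regular hx.1).1 (ne_of_mem_regular hx.1).2
      (inv_lt_one_of_notMem_Ioo hx) hD)

lemma stieltjesFormula_of_Ioi_inv (hD : D = A + B + C + μ - 1)
    (hf : ∀ y : ℝ, y ≠ 0 → 1 - y ≠ 0 → y⁻¹ < 1 → (∀ n : ℕ, C ≠ -(n : ℂ)) →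
      f y = absPow y (1 - μ - B - C) * absPow (1 - y) (B - 1) *
      gaussF (B + C + μ - 1) (1 - μ - A) C y⁻¹)
    (hg : ∀ x : ℝ, x ≠ 0 → 1 - x ≠ 0 → x < 1 → (∀ n : ℕ, A + B + C + μ - 1 ≠ -(n : ℂ)) →
      g x = absPow (1 - x) (B + μ - 1) *
      gaussF B (B + C + μ - 1) (A + B + C + μ - 1) x) :
    StieltjesFormula (Ioi 1) μ f g A B C D := by
  subst hD
  exact (stieltjesFormula_Ioi_inv μ A B C).congr measurableSet_Ioi
    (fun hC y hy => hf y (ne_of_mem_regular (Or.inr hy)).1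
      (ne_of_mem_regular (Or.inr hy)).2 (inv_lt_one_of_one_lt₀ hy) hC)
    (fun hD x hx => hg x (ne_of_mem_regular hx.1).1 (ne_of_mem_regular hx.1).2
      (lt_one_of_notMem_Ioi hx) hD)

lemma stieltjesFormula_of_Ioi_one_sub (hD : D = A + B + C + μ - 1)
    (hf : ∀ y : ℝ, y ≠ 0 → 1 - y ≠ 0 → 1 - y < 1 → (∀ n : ℕ, C ≠ -(n : ℂ)) →
      f y = absPow (1 - y) (C - 1) *
      gaussF (A + C + μ - 1) (B + C + μ - 1) C (1 - y))
    (hg : ∀ x : ℝ, x ≠ 0 → 1 - x ≠ 0 → x < 1 → (∀ n : ℕ, A + B + C + μ - 1 ≠ -(n : ℂ)) →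
      g x = gaussF A B (A + B + C + μ - 1) x) :
    StieltjesFormula (Ioi 1) μ f g A B C D := by
  subst hD
  exact (stieltjesFormula_Ioi_one_sub μ A B C).congr measurableSet_Ioi
    (fun hC y hy => hf y (ne_of_mem_regular (Or.inr hy)).1
      (ne_of_mem_regular (Or.inr hy)).2 (by linarith [mem_Ioi.1 hy]) hC)
    (fun hD x hx => hg x (ne_of_mem_regular hx.1).1 (ne_of_mem_regular hx.1).2
      (lt_one_of_notMem_Ioi hx) hD)

lemma stieltjesFormula_of_Iio (hD : D = A + B + C + μ - 1)
    (hf : ∀ y : ℝ, y ≠ 0 → 1 - y ≠ 0 → y < 1 → (∀ n : ℕ, C ≠ -(n : ℂ)) →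
      f y = absPow y (C - 1) *
      gaussF (A + C + μ - 1) (B + C + μ - 1) C y)
    (hg : ∀ x : ℝ, x ≠ 0 → 1 - x ≠ 0 → 1 - x < 1 → (∀ n : ℕ, A + B + C + μ - 1 ≠ -(n : ℂ)) →
      g x = gaussF A B (A + B + C + μ - 1) (1 - x)) :
    StieltjesFormula (Iio 0) μ f g A B C D := by
  subst hD
  exact (stieltjesFormula_Iio μ A B C).congr measurableSet_Iio
    (fun hC y hy => hf y (ne_of_mem_regular (Or.inl (Or.inl hy))).1
      (ne_of_mem_regular (Or.inl (Or.inl hy))).2 (lt_trans hy one_pos) hC)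
    (fun hD x hx => hg x (ne_of_mem_regular hx.1).1 (ne_of_mem_regular hx.1).2
      (by linarith [pos_of_notMem_Iio hx]) hD)

lemma stieltjesFormula_of_Iio_inv (hD : D = A + B + C + μ - 1)
    (hf : ∀ y : ℝ, y ≠ 0 → 1 - y ≠ 0 → y⁻¹ < 1 → (∀ n : ℕ, C ≠ -(n : ℂ)) →
      f y = absPow y (-C - μ) *
      gaussF (A + C + μ - 1) (B + C + μ - 1) C y⁻¹)
    (hg : ∀ x : ℝ, x ≠ 0 → 1 - x ≠ 0 → 1 - x < 1 → (∀ n : ℕ, A + B + C + μ - 1 ≠ -(n : ℂ)) →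
      g x = absPow x (B + μ - 1) *
      gaussF B (B + C + μ - 1) (A + B + C + μ - 1) (1 - x)) :
    StieltjesFormula (Iio 0) μ f g A B C D := by
  subst hD
  exact (stieltjesFormula_Iio_inv μ A B C).congr measurableSet_Iio
    (fun hC y hy => hf y (ne_of_mem_regular (Or.inl (Or.inl hy))).1
      (ne_of_mem_regular (Or.inl (Or.inl hy))).2 ((inv_lt_zero.2 hy).trans one_pos) hC)
    (fun hD x hx => hg x (ne_of_mem_regular hx.1).1 (ne_of_mem_regular hx.1).2
      (by linarith [pos_of_notMem_Iio hx]) hD)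

end GaussStieltjes

open GaussStieltjes

/-! ### The 24 formulas. -/

theorem mainTheorem5 (a b c μ : ℂ) :
    -- Case c+
    StieltjesFormula (Iio 0) μ
      (fun y => absPow y (c - 1) * w₁ a b c y)
      (fun x => absPow x (c - 1 + μ) * w₅ a b (c + μ) x)
      (a - c - μ + 1) (b - c - μ + 1) c (a + b - c - μ + 1) ∧
    StieltjesFormula (Ioi 1) μ
      (fun y => absPow y (c - 1) * w₆ a b c y)
      (fun x => absPow x (c - 1 + μ) * w₂ a b (c + μ) x)
      (a - c - μ + 1) (b - c - μ + 1) (c - a - b + 1) (2 - c - μ) ∧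
    -- Case a+, c+
    StieltjesFormula (Ioo 0 1) μ
      (fun y => absPow y (c - 1) * absPow (1 - y) (b - c - μ) * w₁ a b c y)
      (fun x => absPow x (c - 1 + μ) * absPow (1 - x) (b - c) * w₄ (a + μ) b (c + μ) x)
      (-a - μ + 1) (b - c - μ + 1) c (b - a - μ + 1) ∧
    StieltjesFormula (Ioi 1) μ
      (fun y => absPow y (c - 1) * absPow (1 - y) (b - c - μ) * w₃ a b c y)
      (fun x => absPow x (c - 1 + μ) * absPow (1 - x) (b - c) * w₂ (a + μ) b (c + μ) x)
      (-a - μ + 1) (b - c - μ + 1) (a - b + 1) (2 - c - μ) ∧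
    -- Case b+, c+
    StieltjesFormula (Ioo 0 1) μ
      (fun y => absPow y (c - 1) * absPow (1 - y) (a - c - μ) * w₁ a b c y)
      (fun x => absPow x (c - 1 + μ) * absPow (1 - x) (a - c) * w₃ a (b + μ) (c + μ) x)
      (-b - μ + 1) (a - c - μ + 1) c (a - b - μ + 1) ∧
    StieltjesFormula (Ioi 1) μ
      (fun y => absPow y (c - 1) * absPow (1 - y) (a - c - μ) * w₄ a b c y)
      (fun x => absPow x (c - 1 + μ) * absPow (1 - x) (a - c) * w₂ a (b + μ) (c + μ) x)
      (-b - μ + 1) (a - c - μ + 1) (b - a + 1) (2 - c - μ) ∧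
    -- Case a+, b+, c+
    StieltjesFormula (Iio 0) μ
      (fun y => absPow y (c - 1) * absPow (1 - y) (a + b - c) * w₁ a b c y)
      (fun x => absPow x (c - 1 + μ) * absPow (1 - x) (a + b - c + μ) * w₆ (a + μ) (b + μ) (c + μ) x)
      (-a - μ + 1) (-b - μ + 1) c (c - a - b - μ + 1) ∧
    StieltjesFormula (Ioi 1) μ
      (fun y => absPow y (c - 1) * absPow (1 - y) (a + b - c) * w₅ a b c y)
      (fun x => absPow x (c - 1 + μ) * absPow (1 - x) (a + b - c + μ) * w₂ (a + μ) (b + μ) (c + μ) x)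
      (-a - μ + 1) (-b - μ + 1) (a + b - c + 1) (2 - c - μ) ∧
    -- Case a-
    StieltjesFormula (Iio 0) μ
      (fun y => absPow y (a - μ - 1) * w₄ a b c y)
      (fun x => absPow x (a - 1) * w₅ (a - μ) b c x)
      (a - μ) (a - c - μ + 1) (b - a + 1) (a + b - c - μ + 1) ∧
    StieltjesFormula (Ioo 0 1) μ
      (fun y => absPow y (a - μ - 1) * w₆ a b c y)
      (fun x => absPow x (a - 1) * w₃ (a - μ) b c x)
      (a - c - μ + 1) (a - μ) (c - a - b + 1) (a - b - μ + 1) ∧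
    -- Case b-
    StieltjesFormula (Iio 0) μ
      (fun y => absPow y (b - μ - 1) * w₃ a b c y)
      (fun x => absPow x (b - 1) * w₅ a (b - μ) c x)
      (b - μ) (b - c - μ + 1) (a - b + 1) (a + b - c - μ + 1) ∧
    StieltjesFormula (Ioo 0 1) μ
      (fun y => absPow y (b - μ - 1) * w₆ a b c y)
      (fun x => absPow x (b - 1) * w₄ a (b - μ) c x)
      (b - c - μ + 1) (b - μ) (c - a - b + 1) (b - a - μ + 1) ∧
    -- Case a+
    StieltjesFormula (Iio 0) μ
      (fun y => absPow y (c - a - μ - 1) * absPow (1 - y) (a + b - c) * w₃ a b c y)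
      (fun x => absPow x (c - a - 1) * absPow (1 - x) (a + b - c + μ) * w₆ (a + μ) b c x)
      (-a - μ + 1) (c - a - μ) (a - b + 1) (c - a - b - μ + 1) ∧
    StieltjesFormula (Ioo 0 1) μ
      (fun y => absPow y (c - a - μ - 1) * absPow (1 - y) (a + b - c) * w₅ a b c y)
      (fun x => absPow x (c - a - 1) * absPow (1 - x) (a + b - c + μ) * w₄ (a + μ) b c x)
      (-a - μ + 1) (c - a - μ) (a + b - c + 1) (b - a - μ + 1) ∧
    -- Case b+
    StieltjesFormula (Iio 0) μ
      (fun y => absPow y (c - b - μ - 1) * absPow (1 - y) (a + b - c) * w₄ a b c y)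
      (fun x => absPow x (c - b - 1) * absPow (1 - x) (a + b - c + μ) * w₆ a (b + μ) c x)
      (-b - μ + 1) (c - b - μ) (b - a + 1) (c - a - b - μ + 1) ∧
    StieltjesFormula (Ioo 0 1) μ
      (fun y => absPow y (c - b - μ - 1) * absPow (1 - y) (a + b - c) * w₅ a b c y)
      (fun x => absPow x (c - b - 1) * absPow (1 - x) (a + b - c + μ) * w₃ a (b + μ) c x)
      (-b - μ + 1) (c - b - μ) (a + b - c + 1) (a - b - μ + 1) ∧
    -- Case a-, b-, c-
    StieltjesFormula (Iio 0) μ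
      (fun y => w₂ a b c y)
      (fun x => w₅ (a - μ) (b - μ) (c - μ) x)
      (a - μ) (b - μ) (2 - c) (a + b - c - μ + 1) ∧
    StieltjesFormula (Ioi 1) μ
      (fun y => w₆ a b c y)
      (fun x => w₁ (a - μ) (b - μ) (c - μ) x)
      (a - μ) (b - μ) (c - a - b + 1) (c - μ) ∧
    -- Case a-, c-
    StieltjesFormula (Ioo 0 1) μ
      (fun y => absPow (1 - y) (a - μ - 1) * w₂ a b c y)
      (fun x => absPow (1 - x) (a - 1) * w₃ (a - μ) b (c - μ) x)
      (c - b - μ) (a - μ) (2 - c) (a - b - μ + 1) ∧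
    StieltjesFormula (Ioi 1) μ
      (fun y => absPow (1 - y) (a - μ - 1) * w₄ a b c y)
      (fun x => absPow (1 - x) (a - 1) * w₁ (a - μ) b (c - μ) x)
      (c - b - μ) (a - μ) (b - a + 1) (c - μ) ∧
    -- Case b-, c-
    StieltjesFormula (Ioo 0 1) μ
      (fun y => absPow (1 - y) (b - μ - 1) * w₂ a b c y)
      (fun x => absPow (1 - x) (b - 1) * w₄ a (b - μ) (c - μ) x)
      (c - a - μ) (b - μ) (2 - c) (b - a - μ + 1) ∧
    StieltjesFormula (Ioi 1) μ
      (fun y => absPow (1 - y) (b - μ - 1) * w₃ a b c y)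
      (fun x => absPow (1 - x) (b - 1) * w₁ a (b - μ) (c - μ) x)
      (c - a - μ) (b - μ) (a - b + 1) (c - μ) ∧
    -- Case c-
    StieltjesFormula (Iio 0) μ
      (fun y => absPow (1 - y) (a + b - c) * w₂ a b c y)
      (fun x => absPow (1 - x) (a + b - c + μ) * w₆ a b (c - μ) x)
      (c - a - μ) (c - b - μ) (2 - c) (c - a - b - μ + 1) ∧
    StieltjesFormula (Ioi 1) μ
      (fun y => absPow (1 - y) (a + b - c) * w₅ a b c y)
      (fun x => absPow (1 - x) (a + b - c + μ) * w₁ a b (c - μ) x)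
      (c - a - μ) (c - b - μ) (a + b - c + 1) (c - μ) := by
  refine ⟨?_, ?_, ?_, ?_, ?_, ?_, ?_, ?_, ?_, ?_, ?_, ?_, ?_, ?_, ?_, ?_, ?_, ?_, ?_, ?_, ?_, ?_, ?_, ?_⟩
  -- In every case the interval and the argument of the integrand's `gaussF` select the base form.
  · refine stieltjesFormula_of_Iio (by ring) (fun y h0 h1 hy hC => ?_) (fun x h0 h1 hx hD => ?_)
    · refine eq_of_absPow₂_mul y ?_
      simp only [w₁]
      simp only [absPow_eq_absPow₂ y, ← mul_assoc, absPow₂_mul h0 h1]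
      congr 2 <;> ring
    · refine eq_of_absPow₂_mul x ?_
      simp only [w₅]
      -- Euler's transformation of the base form supplies |x|^(D-A-B) = |x|^(C+μ-1), the power
      -- standing before w₅.
      rw [gaussF_euler _ _ hD hx]
      simp only [sub_sub_cancel, absPow_eq_absPow₂ x, ← mul_assoc, absPow₂_mul h0 h1]
      conv_lhs => rw [gaussF_comm]
      congr 2 <;> ring
  · refine stieltjesFormula_of_Ioi_one_sub (by ring) (fun y h0 h1 hy hC => ?_) (fun x h0 h1 hx hD => ?_)
    · refine eq_of_absPow₂_mul y ?_
      simp only [w₆]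
      rw [gaussF_euler _ _ hC hy]
      simp only [sub_sub_cancel, absPow_eq_absPow₂ y, absPow_one_sub_eq_absPow₂ y, ← mul_assoc,
          absPow₂_mul h0 h1]
      congr 2 <;> ring
    · refine eq_of_absPow₂_mul x ?_
      simp only [w₂]
      simp only [absPow_eq_absPow₂ x, ← mul_assoc, absPow₂_mul h0 h1]
      congr 2 <;> ring
  · refine stieltjesFormula_of_Ioo (by ring) (fun y h0 h1 hy hC => ?_) (fun x h0 h1 hx hD => ?_)
    · refine eq_of_absPow₂_mul y ?_
      simp only [w₁]
      simp only [absPow_eq_absPow₂ y, absPow_one_sub_eq_absPow₂ y, ← mul_assoc,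
          absPow₂_mul h0 h1]
      conv_lhs => rw [gaussF_comm]
      congr 2 <;> ring
    · refine eq_of_absPow₂_mul x ?_
      simp only [w₄]
      simp only [absPow_eq_absPow₂ x, absPow_one_sub_eq_absPow₂ x, ← mul_assoc,
          absPow₂_mul h0 h1]
      conv_lhs => rw [gaussF_comm]
      congr 2 <;> ring
  · refine stieltjesFormula_of_Ioi_inv (by ring) (fun y h0 h1 hy hC => ?_) (fun x h0 h1 hx hD => ?_)
    · refine eq_of_absPow₂_mul y ?_
      simp only [w₃]
      simp only [absPow_eq_absPow₂ y, absPow_one_sub_eq_absPow₂ y, ← mul_assoc,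
          absPow₂_mul h0 h1]
      conv_lhs => rw [gaussF_comm]
      congr 2 <;> ring
    · refine eq_of_absPow₂_mul x ?_
      simp only [w₂]
      simp only [absPow_eq_absPow₂ x, absPow_one_sub_eq_absPow₂ x, ← mul_assoc,
          absPow₂_mul h0 h1]
      conv_lhs => rw [gaussF_comm]
      congr 2 <;> ring
  · refine stieltjesFormula_of_Ioo (by ring) (fun y h0 h1 hy hC => ?_) (fun x h0 h1 hx hD => ?_)
    · refine eq_of_absPow₂_mul y ?_
      simp only [w₁]
      simp only [absPow_eq_absPow₂ y, absPow_one_sub_eq_absPow₂ y, ← mul_assoc,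
          absPow₂_mul h0 h1]
      congr 2 <;> ring
    · refine eq_of_absPow₂_mul x ?_
      simp only [w₃]
      simp only [absPow_eq_absPow₂ x, absPow_one_sub_eq_absPow₂ x, ← mul_assoc,
          absPow₂_mul h0 h1]
      conv_lhs => rw [gaussF_comm]
      congr 2 <;> ring
  · refine stieltjesFormula_of_Ioi_inv (by ring) (fun y h0 h1 hy hC => ?_) (fun x h0 h1 hx hD => ?_)
    · refine eq_of_absPow₂_mul y ?_
      simp only [w₄]
      simp only [absPow_eq_absPow₂ y, absPow_one_sub_eq_absPow₂ y, ← mul_assoc,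
          absPow₂_mul h0 h1]
      conv_lhs => rw [gaussF_comm]
      congr 2 <;> ring
    · refine eq_of_absPow₂_mul x ?_
      simp only [w₂]
      simp only [absPow_eq_absPow₂ x, absPow_one_sub_eq_absPow₂ x, ← mul_assoc,
          absPow₂_mul h0 h1]
      congr 2 <;> ring
  · refine stieltjesFormula_of_Iio (by ring) (fun y h0 h1 hy hC => ?_) (fun x h0 h1 hx hD => ?_)
    · refine eq_of_absPow₂_mul y ?_
      simp only [w₁]
      rw [gaussF_euler _ _ hC hy]
      simp only [absPow_eq_absPow₂ y, absPow_one_sub_eq_absPow₂ y, ← mul_assoc,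
          absPow₂_mul h0 h1]
      congr 2 <;> ring
    · refine eq_of_absPow₂_mul x ?_
      simp only [w₆]
      rw [gaussF_euler _ _ hD hx]
      simp only [sub_sub_cancel, absPow_eq_absPow₂ x, absPow_one_sub_eq_absPow₂ x, ← mul_assoc,
          absPow₂_mul h0 h1]
      conv_lhs => rw [gaussF_comm]
      congr 2 <;> ring
  · refine stieltjesFormula_of_Ioi_one_sub (by ring) (fun y h0 h1 hy hC => ?_) (fun x h0 h1 hx hD => ?_)
    · refine eq_of_absPow₂_mul y ?_
      simp only [w₅]
      rw [gaussF_euler _ _ hC hy]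
      simp only [sub_sub_cancel, absPow_eq_absPow₂ y, absPow_one_sub_eq_absPow₂ y, ← mul_assoc,
          absPow₂_mul h0 h1]
      congr 2 <;> ring
    · refine eq_of_absPow₂_mul x ?_
      simp only [w₂]
      rw [gaussF_euler _ _ hD hx]
      simp only [absPow_eq_absPow₂ x, absPow_one_sub_eq_absPow₂ x, ← mul_assoc,
          absPow₂_mul h0 h1]
      congr 2 <;> ring
  · refine stieltjesFormula_of_Iio_inv (by ring) (fun y h0 h1 hy hC => ?_) (fun x h0 h1 hx hD => ?_)
    · refine eq_of_absPow₂_mul y ?_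
      simp only [w₄]
      simp only [absPow_eq_absPow₂ y, ← mul_assoc, absPow₂_mul h0 h1]
      congr 2 <;> ring
    · refine eq_of_absPow₂_mul x ?_
      simp only [w₅]
      rw [gaussF_euler _ _ hD hx]
      simp only [sub_sub_cancel, absPow_eq_absPow₂ x, ← mul_assoc, absPow₂_mul h0 h1]
      conv_lhs => rw [gaussF_comm]
      congr 2 <;> ring
  · refine stieltjesFormula_of_Ioo_one_sub (by ring) (fun y h0 h1 hy hC => ?_) (fun x h0 h1 hx hD => ?_)
    · refine eq_of_absPow₂_mul y ?_
      simp only [w₆]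
      simp only [absPow_eq_absPow₂ y, absPow_one_sub_eq_absPow₂ y, ← mul_assoc,
          absPow₂_mul h0 h1]
      conv_lhs => rw [gaussF_comm]
      congr 2 <;> ring
    · refine eq_of_absPow₂_mul x ?_
      simp only [w₃]
      simp only [absPow_eq_absPow₂ x, ← mul_assoc, absPow₂_mul h0 h1]
      conv_lhs => rw [gaussF_comm]
      congr 2 <;> ring
  · refine stieltjesFormula_of_Iio_inv (by ring) (fun y h0 h1 hy hC => ?_) (fun x h0 h1 hx hD => ?_)
    · refine eq_of_absPow₂_mul y ?_
      simp only [w₃]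
      simp only [absPow_eq_absPow₂ y, ← mul_assoc, absPow₂_mul h0 h1]
      congr 2 <;> ring
    · refine eq_of_absPow₂_mul x ?_
      simp only [w₅]
      rw [gaussF_euler _ _ hD hx]
      simp only [sub_sub_cancel, absPow_eq_absPow₂ x, ← mul_assoc, absPow₂_mul h0 h1]
      congr 2 <;> ring
  · refine stieltjesFormula_of_Ioo_one_sub (by ring) (fun y h0 h1 hy hC => ?_) (fun x h0 h1 hx hD => ?_)
    · refine eq_of_absPow₂_mul y ?_
      simp only [w₆]
      simp only [absPow_eq_absPow₂ y, absPow_one_sub_eq_absPow₂ y, ← mul_assoc,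
          absPow₂_mul h0 h1]
      congr 2 <;> ring
    · refine eq_of_absPow₂_mul x ?_
      simp only [w₄]
      simp only [absPow_eq_absPow₂ x, ← mul_assoc, absPow₂_mul h0 h1]
      conv_lhs => rw [gaussF_comm]
      congr 2 <;> ring
  · refine stieltjesFormula_of_Iio_inv (by ring) (fun y h0 h1 hy hC => ?_) (fun x h0 h1 hx hD => ?_)
    · refine eq_of_absPow₂_mul y ?_
      simp only [w₃]
      -- In the variable 1/y, Euler's transformation yields a power of 1 - 1/y, which
      -- `absPow_one_sub_inv` splits into powers of 1 - y and y.
      rw [gaussF_euler _ _ hC hy]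
      simp only [absPow_one_sub_inv h0, absPow_eq_absPow₂ y, absPow_one_sub_eq_absPow₂ y, ← mul_assoc,
          absPow₂_mul h0 h1]
      congr 2 <;> ring
    · refine eq_of_absPow₂_mul x ?_
      simp only [w₆]
      simp only [absPow_eq_absPow₂ x, absPow_one_sub_eq_absPow₂ x, ← mul_assoc,
          absPow₂_mul h0 h1]
      congr 2 <;> ring
  · refine stieltjesFormula_of_Ioo_one_sub (by ring) (fun y h0 h1 hy hC => ?_) (fun x h0 h1 hx hD => ?_)
    · refine eq_of_absPow₂_mul y ?_
      simp only [w₅]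
      simp only [absPow_eq_absPow₂ y, absPow_one_sub_eq_absPow₂ y, ← mul_assoc,
          absPow₂_mul h0 h1]
      conv_lhs => rw [gaussF_comm]
      congr 2 <;> ring
    · refine eq_of_absPow₂_mul x ?_
      simp only [w₄]
      rw [gaussF_euler _ _ hD hx]
      simp only [absPow_one_sub_inv h0, absPow_eq_absPow₂ x, absPow_one_sub_eq_absPow₂ x, ← mul_assoc,
          absPow₂_mul h0 h1]
      congr 2 <;> ring
  · refine stieltjesFormula_of_Iio_inv (by ring) (fun y h0 h1 hy hC => ?_) (fun x h0 h1 hx hD => ?_)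
    · refine eq_of_absPow₂_mul y ?_
      simp only [w₄]
      rw [gaussF_euler _ _ hC hy]
      simp only [absPow_one_sub_inv h0, absPow_eq_absPow₂ y, absPow_one_sub_eq_absPow₂ y, ← mul_assoc,
          absPow₂_mul h0 h1]
      congr 2 <;> ring
    · refine eq_of_absPow₂_mul x ?_
      simp only [w₆]
      simp only [absPow_eq_absPow₂ x, absPow_one_sub_eq_absPow₂ x, ← mul_assoc,
          absPow₂_mul h0 h1]
      conv_lhs => rw [gaussF_comm]
      congr 2 <;> ring
  · refine stieltjesFormula_of_Ioo_one_sub (by ring) (fun y h0 h1 hy hC => ?_) (fun x h0 h1 hx hD => ?_)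
    · refine eq_of_absPow₂_mul y ?_
      simp only [w₅]
      simp only [absPow_eq_absPow₂ y, absPow_one_sub_eq_absPow₂ y, ← mul_assoc,
          absPow₂_mul h0 h1]
      congr 2 <;> ring
    · refine eq_of_absPow₂_mul x ?_
      simp only [w₃]
      rw [gaussF_euler _ _ hD hx]
      simp only [absPow_one_sub_inv h0, absPow_eq_absPow₂ x, absPow_one_sub_eq_absPow₂ x, ← mul_assoc,
          absPow₂_mul h0 h1]
      congr 2 <;> ring
  · refine stieltjesFormula_of_Iio (by ring) (fun y h0 h1 hy hC => ?_) (fun x h0 h1 hx hD => ?_)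
    · refine eq_of_absPow₂_mul y ?_
      simp only [w₂]
      simp only [absPow_eq_absPow₂ y, ← mul_assoc, absPow₂_mul h0 h1]
      congr 2 <;> ring
    · rw [w₅]
      congr 1
      ring
  · refine stieltjesFormula_of_Ioi_one_sub (by ring) (fun y h0 h1 hy hC => ?_) (fun x h0 h1 hx hD => ?_)
    · refine eq_of_absPow₂_mul y ?_
      simp only [w₆]
      simp only [absPow_one_sub_eq_absPow₂ y, ← mul_assoc, absPow₂_mul h0 h1]
      conv_lhs => rw [gaussF_comm]
      congr 2 <;> ring
    · rw [w₁]
      congr 1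
      ring
  · refine stieltjesFormula_of_Ioo (by ring) (fun y h0 h1 hy hC => ?_) (fun x h0 h1 hx hD => ?_)
    · refine eq_of_absPow₂_mul y ?_
      simp only [w₂]
      simp only [absPow_eq_absPow₂ y, absPow_one_sub_eq_absPow₂ y, ← mul_assoc,
          absPow₂_mul h0 h1]
      congr 2 <;> ring
    · refine eq_of_absPow₂_mul x ?_
      simp only [w₃]
      simp only [absPow_eq_absPow₂ x, absPow_one_sub_eq_absPow₂ x, ← mul_assoc,
          absPow₂_mul h0 h1]
      congr 2 <;> ring
  · refine stieltjesFormula_of_Ioi_inv (by ring) (fun y h0 h1 hy hC => ?_) (fun x h0 h1 hx hD => ?_)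
    · refine eq_of_absPow₂_mul y ?_
      simp only [w₄]
      simp only [absPow_eq_absPow₂ y, absPow_one_sub_eq_absPow₂ y, ← mul_assoc,
          absPow₂_mul h0 h1]
      congr 2 <;> ring
    · refine eq_of_absPow₂_mul x ?_
      simp only [w₁]
      simp only [absPow_one_sub_eq_absPow₂ x, ← mul_assoc, absPow₂_mul h0 h1]
      congr 2 <;> ring
  · refine stieltjesFormula_of_Ioo (by ring) (fun y h0 h1 hy hC => ?_) (fun x h0 h1 hx hD => ?_)
    · refine eq_of_absPow₂_mul y ?_
      simp only [w₂]
      simp only [absPow_eq_absPow₂ y, absPow_one_sub_eq_absPow₂ y, ← mul_assoc,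
          absPow₂_mul h0 h1]
      conv_lhs => rw [gaussF_comm]
      congr 2 <;> ring
    · refine eq_of_absPow₂_mul x ?_
      simp only [w₄]
      simp only [absPow_eq_absPow₂ x, absPow_one_sub_eq_absPow₂ x, ← mul_assoc,
          absPow₂_mul h0 h1]
      congr 2 <;> ring
  · refine stieltjesFormula_of_Ioi_inv (by ring) (fun y h0 h1 hy hC => ?_) (fun x h0 h1 hx hD => ?_)
    · refine eq_of_absPow₂_mul y ?_
      simp only [w₃]
      simp only [absPow_eq_absPow₂ y, absPow_one_sub_eq_absPow₂ y, ← mul_assoc,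
          absPow₂_mul h0 h1]
      congr 2 <;> ring
    · refine eq_of_absPow₂_mul x ?_
      simp only [w₁]
      simp only [absPow_one_sub_eq_absPow₂ x, ← mul_assoc, absPow₂_mul h0 h1]
      conv_lhs => rw [gaussF_comm]
      congr 2 <;> ring
  · refine stieltjesFormula_of_Iio (by ring) (fun y h0 h1 hy hC => ?_) (fun x h0 h1 hx hD => ?_)
    · refine eq_of_absPow₂_mul y ?_
      simp only [w₂]
      rw [gaussF_euler _ _ hC hy]
      simp only [absPow_eq_absPow₂ y, absPow_one_sub_eq_absPow₂ y, ← mul_assoc,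
          absPow₂_mul h0 h1]
      congr 2 <;> ring
    · refine eq_of_absPow₂_mul x ?_
      simp only [w₆]
      simp only [absPow_one_sub_eq_absPow₂ x, ← mul_assoc, absPow₂_mul h0 h1]
      congr 2 <;> ring
  · refine stieltjesFormula_of_Ioi_one_sub (by ring) (fun y h0 h1 hy hC => ?_) (fun x h0 h1 hx hD => ?_)
    · refine eq_of_absPow₂_mul y ?_
      simp only [w₅]
      simp only [absPow_one_sub_eq_absPow₂ y, ← mul_assoc, absPow₂_mul h0 h1]
      conv_lhs => rw [gaussF_comm]
      congr 2 <;> ring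
    · refine eq_of_absPow₂_mul x ?_
      simp only [w₁]
      rw [gaussF_euler _ _ hD hx]
      simp only [absPow_one_sub_eq_absPow₂ x, ← mul_assoc, absPow₂_mul h0 h1]
      congr 2 <;> ring
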